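/- Let $\hbar,\omega,\beta>0$ and $a=\hbar\omega\beta$. For every $N$ consider the canonical ensemble at inverse temperature $\beta$ of $N$ noninteracting bosons in the one-dimensional harmonic trap whose frequency $\omega$ is replaced by $\omega_N=\omega\ln N/N$ (so that $a$ is replaced by $a_N=a\ln N/N$): the one-particle levels are $\varepsilon_j=\hbar\omega_N(j+\tfrac12)$, $j=0,1,2,\dots$; a family of occupation numbers $(n_j)_{j\ge0}$ with $\sum_j n_j=N$ has probability $e^{-\beta\sum_j n_j\varepsilon_j}/Z_N$, where $Z_N=\sum_{(n_j):\,\sum_j n_j=N}e^{-\beta\sum_j n_j\varepsilon_j}$ (the sum converges for $N\ge2$). Write $P_N$ and $\langle\cdot\rangle_N$ for probabilities and mean values in this ensemble, and $F^0_N=-\beta^{-1}\ln Z_N$ for the free energy. There is a phase transition at $a=1$: for $a\le1$ there is no Bose-Einstein condensation ($\max_j\langle n_j\rangle_N=o(N)$), while for $a>1$ there is ($\langle n_0\rangle_N\ge cN$ for some $c>0$ and all large $N$). In detail, as $N\to\infty$: I. Limit distribution of $n_0$. (i) For $0<a<1$ and $x\ge0$: $\lim_{N\to\infty}P_N\left(n_0/N^a\ge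 x\right)=e^{-x}$. (ii) For $a\ge1$ and every real sequence $\lambda_N\to\lambda\in(0,1)$: $\lim_{N\to\infty}P_N\left(n_0/N\ge\lambda_N\right)$ equals $1$ if $\lambda<1-a^{-1}$ and $0$ if $\lambda>1-a^{-1}$. (iii) For $a\ge1$ and every real $x$, $$\lim_{N\to\infty}P_N\left(\left[\frac{n_0}{N}-1+a^{-1}\right]\ln N-a^{-1}\ln\ln N\ge x\right)=\exp\{-a^{-1}e^{ax}\}$$ and $$\lim_{N\to\infty}P_N\left(\frac{\ln N}{N}\left(n_0-\langle n_0\rangle_N\right)\ge x\right)=\exp\{-a^{-1}e^{a(x+\eta(a))}\},$$ where $\eta(a)=\int_{-\infty}^{\infty}x\exp\{ax-a^{-1}e^{ax}\}\,dx$ (an absolutely convergent integral). II. Mean value of $n_0$. (i) For $0<a<1$: $\lim_{N\to\infty}\langle n_0\rangle_N/N^a=1$. (ii) For $a\ge1$: $$\langle n_0\rangle_N=(1-a^{-1})N+\frac{N}{\ln N}\left[a^{-1}\ln\ln N+\eta(a)\right]+o\left(\frac{N}{\ln N}\right);$$ in particular $\lim_{N\to\infty}\langle n_0\rangle_N/N=1-1/a$.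 III. For every $a>0$: $F^0_N=-\dfrac{\pi^2}{6\beta a}\,\dfrac{N}{\ln N}+o\left(\dfrac{N}{\ln N}\right)$. -/

import Mathlib

open Filter Topology MeasureTheory

namespace IdealBoseGas

noncomputable section

/-- The occupation-number basis states of the symmetric `N`-particle space over a one-particle space
with basis `φ₀, φ₁, φ₂, …`: finitely supported families `(n_j)` of naturals with `∑ n_j = N`. -/
def Config (N : ℕ) : Type :=
  {n : ℕ →₀ ℕ // (n.sum fun _ k => k) = N}

/-- The occupation number `n_j` of the level `j` in the basis state `n`. -/
def occ {N : ℕ} (j : ℕ) (n : Config N) : ℕ := n.1 j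

/-- The energy `∑ n_j ε_j` of the basis state `n`, for one-particle energy levels `ε`. -/
def energy (ε : ℕ → ℝ) {N : ℕ} (n : Config N) : ℝ :=
  n.1.sum fun j k => (k : ℝ) * ε j

/-- The Boltzmann weight `exp (-β ∑ n_j ε_j)`. -/
def weight (β : ℝ) (ε : ℕ → ℝ) {N : ℕ} (n : Config N) : ℝ :=
  Real.exp (-(β * energy ε n))

/-- The canonical partition function: the trace of `exp (-β H)` over the symmetric `N`-particle
space, where `H` is the noninteracting Hamiltonian with one-particle levels `ε`. -/
def partitionFunction (β : ℝ) (ε : ℕ → ℝ) (N : ℕ) : ℝ :=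
  ∑' n : Config N, weight β ε n

/-- The canonical probability of a set of basis states. -/
def prob (β : ℝ) (ε : ℕ → ℝ) {N : ℕ} (A : Set (Config N)) : ℝ :=
  (∑' n : Config N, A.indicator (weight β ε) n) / partitionFunction β ε N

/-- The canonical mean value of an observable that is diagonal in the occupation-number basis. -/
def mean (β : ℝ) (ε : ℕ → ℝ) {N : ℕ} (X : Config N → ℝ) : ℝ :=
  (∑' n : Config N, X n * weight β ε n) / partitionFunction β ε N

/-- The canonical mean occupation number of the level `j`. -/
def meanOcc (β : ℝ) (ε : ℕ → ℝ) (N j : ℕ) : ℝ :=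
  mean β ε fun n : Config N => (occ j n : ℝ)

/-- The free energy `-β⁻¹ log Z`. -/
def freeEnergy (β : ℝ) (ε : ℕ → ℝ) (N : ℕ) : ℝ :=
  -(1 / β) * Real.log (partitionFunction β ε N)

/-- The (simple) eigenvalues of the harmonic oscillator `-(ħ²/2m) d²/dx² + (1/2) m Ω² x²`
of frequency `Ω`, ground-state energy included: `ħ Ω (j + 1/2)`. -/
def oscillatorLevel (hbar Ω : ℝ) (j : ℕ) : ℝ :=
  hbar * Ω * ((j : ℝ) + 1 / 2)

/-- The one-particle levels in the scaled trap for `N` particles, in which the frequency `ω` is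
replaced by `ω (log N) / N`. -/
def trapLevel (hbar ω : ℝ) (N : ℕ) : ℕ → ℝ :=
  oscillatorLevel hbar (ω * (Real.log N / N))

/-- The canonical probability, in the scaled trap with `N` particles, that the ground-state
occupation number satisfies `S`. -/
def groundProb (hbar ω β : ℝ) (N : ℕ) (S : ℝ → Prop) : ℝ :=
  prob β (trapLevel hbar ω N) {n : Config N | S (occ 0 n : ℝ)}

/-- The canonical mean number of particles in the level `j` of the scaled trap with `N` particles. -/
def trapMeanOcc (hbar ω β : ℝ) (N j : ℕ) : ℝ :=
  meanOcc β (trapLevel hbar ω N) N j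

/-- Bose-Einstein condensation into the ground state, for mean occupation numbers `ν N j`:
the ground state is macroscopically occupied. -/
def GroundStateBEC (ν : ℕ → ℕ → ℝ) : Prop :=
  ∃ c : ℝ, 0 < c ∧ ∀ᶠ N : ℕ in atTop, c * N ≤ ν N 0

/-- Absence of Bose-Einstein condensation: the largest mean occupation number of a one-particle
level (the largest eigenvalue of the one-particle density matrix) is `o(N)`. -/
def NoBEC (ν : ℕ → ℕ → ℝ) : Prop :=
  ∀ c : ℝ, 0 < c → ∀ᶠ N : ℕ in atTop, ∀ j : ℕ, ν N j ≤ c * N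

/-- The constant `η(a)`: the mean of the limiting Gumbel law. -/
def eta (a : ℝ) : ℝ :=
  ∫ x : ℝ, x * Real.exp (a * x - a⁻¹ * Real.exp (a * x))

end

end IdealBoseGas

open IdealBoseGas

namespace IdealBoseGas

noncomputable section

/-! Everything rests on an exact product formula. Put s = a_N and q = e^{-s}. Adding a particle to
level 0 maps the (N-1)-particle states bijectively onto the N-particle states with n_0 ≥ 1. Lifting
all particles by one level maps the N-particle states bijectively onto those with n_0 = 0 and, the
levels being equally spaced, multiplies every weight by q^N. Hence (1 - q^N) Z_N = e^{-βε_0} Z_{N-1}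
(`partitionFunction_succ`), and P(n_0 ≥ m) = ∏_{i<m} (1 - q^{N-i}) (`prob_le_occ_zero`).

If s(N - m) → ∞, the factors tend uniformly to 1 and the product behaves like e^{-L} with L =
Σ_{i<m} q^{N-i} (`tendsto_groundTail`). The scaling makes q^N = N^{-a}. For a < 1 and m ≈ x N^a one
has sm → 0, so every term of L is about N^{-a} and L → x. For a ≥ 1 the geometric sum L ≈
e^{-s(N-m)}/s has a limit when e^{-s(N-m)} is of order log N / N; solving for m gives
`gumbelThreshold`, with L → a^{-1} e^{ax}.

Means are integrals of tails. After rescaling and subtraction of the tail of the Dirac law at 0,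
these are dominated by an integrable exponential, so limits pass under the integral; integration by
parts identifies the limit as η(a). The ground state has the largest mean occupation, which settles
the question of condensation. For the free energy, -Σ_k log(1 - q^k) is expanded in powers of q and
summed over k first; s times the result tends to ζ(2). -/

/-! ### Adding and lifting particles; the recursion for the partition function -/

theorem occ_le {N : ℕ} (j : ℕ) (n : Config N) : occ j n ≤ N := by
  by_cases hj : j ∈ n.1.support
  · exact (Finset.single_le_sum (f := fun i => n.1 i) (fun _ _ => Nat.zero_le _) hj).trans_eq n.2
  · simp [occ, Finsupp.notMem_support_iff.mp hj]

theorem weight_pos (β : ℝ) (ε : ℕ → ℝ) {N : ℕ} (n : Config N) : 0 < weight β ε n :=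
  Real.exp_pos _

/-- Put `m` further particles into the level `j`. -/
def addParticles (j m : ℕ) {N : ℕ} (n : Config N) : Config (N + m) :=
  ⟨n.1 + Finsupp.single j m, by
    rw [Finsupp.sum_add_index' (by simp) (by simp), n.2]; simp⟩

theorem weight_addParticles (β : ℝ) (ε : ℕ → ℝ) (j m : ℕ) {N : ℕ} (n : Config N) :
    weight β ε (addParticles j m n) = Real.exp (-(β * (m * ε j))) * weight β ε n := by
  have : energy ε (addParticles j m n) = energy ε n + m * ε j := by
    simp only [energy, addParticles]
    rw [Finsupp.sum_add_index' (by simp) (by intros; push_cast; ring)]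
    simp
  rw [weight, weight, this, ← Real.exp_add]
  ring_nf

theorem addParticles_injective (j m N : ℕ) :
    Function.Injective (addParticles j m : Config N → Config (N + m)) := by
  intro n n' h
  exact Subtype.ext (add_right_cancel (congrArg Subtype.val h))

theorem exists_addParticles_eq {j m N : ℕ} (n : Config (N + m)) (h : m ≤ occ j n) :
    ∃ n' : Config N, addParticles j m n' = n := by
  have hle : Finsupp.single j m ≤ n.1 := by
    rwa [Finsupp.single_le_iff]
  have hadd : n.1 - Finsupp.single j m + Finsupp.single j m = n.1 := tsub_add_cancel_of_le hle
  refine ⟨⟨n.1 - Finsupp.single j m, ?_⟩, Subtype.ext hadd⟩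
  have h2 := n.2
  rw [← hadd, Finsupp.sum_add_index' (by simp) (by simp)] at h2
  simpa using h2

theorem exists_occ_pos {N : ℕ} (n : Config (N + 1)) : ∃ j, 1 ≤ occ j n := by
  by_contra! h
  have h0 : n.1 = 0 := by
    ext j
    have := h j
    simp only [occ] at this
    simpa using this
  have := n.2
  rw [h0] at this
  simp at this

theorem config_zero_eq (n : Config 0) : n = ⟨0, by simp⟩ := by
  apply Subtype.ext
  ext j
  have := occ_le j n
  simpa [occ] using this

/-- Taking one particle out of an occupied level embeds the (N+1)-particle states into pairs (level,
N-particle state), along which the weight factorises. -/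
theorem summable_weight {β : ℝ} {ε : ℕ → ℝ} (h : Summable fun j => Real.exp (-(β * ε j)))
    (N : ℕ) : Summable fun n : Config N => weight β ε n := by
  induction N with
  | zero =>
    have : Subsingleton (Config 0) := ⟨fun n n' => by rw [config_zero_eq n, config_zero_eq n']⟩
    exact Summable.of_finite
  | succ N ih =>
    have hs : ∀ n : Config (N + 1), ∃ p : ℕ × Config N, addParticles p.1 1 p.2 = n := by
      intro n
      obtain ⟨j, hj⟩ := exists_occ_pos n
      obtain ⟨n', hn'⟩ := exists_addParticles_eq n hj
      exact ⟨(j, n'), hn'⟩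
    choose g hg using hs
    have hinj : Function.Injective g := fun n n' hnn => by rw [← hg n, ← hg n', hnn]
    have hprod := h.mul_of_nonneg ih (fun _ => (Real.exp_pos _).le) (fun n => (weight_pos β ε n).le)
    refine (hprod.comp_injective hinj).congr fun n => ?_
    have := weight_addParticles β ε (g n).1 1 (g n).2
    rw [hg n] at this
    simpa using this.symm

theorem partitionFunction_pos {β : ℝ} {ε : ℕ → ℝ} (h : Summable fun j => Real.exp (-(β * ε j)))
    (N : ℕ) : 0 < partitionFunction β ε N := by
  have hN : Nonempty (Config N) := ⟨⟨Finsupp.single 0 N, by simp⟩⟩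
  exact (summable_weight h N).tsum_pos (fun n => (weight_pos β ε n).le) hN.some
    (weight_pos β ε _)

theorem partitionFunction_zero (β : ℝ) (ε : ℕ → ℝ) : partitionFunction β ε 0 = 1 := by
  rw [partitionFunction, tsum_eq_single ⟨0, by simp⟩ fun n hn => absurd (config_zero_eq n) hn]
  simp [weight, energy]

/-- `addParticles j m` is a bijection onto the event m ≤ n_j and multiplies all weights by the same
factor. -/
theorem tsum_indicator_le_occ (β : ℝ) (ε : ℕ → ℝ) (j m N : ℕ) :
    ∑' n : Config (N + m), {n | m ≤ occ j n}.indicator (weight β ε) n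
      = Real.exp (-(β * (m * ε j))) * partitionFunction β ε N := by
  rw [← (addParticles_injective j m N).tsum_eq, partitionFunction, ← tsum_mul_left]
  · refine tsum_congr fun n => ?_
    rw [Set.indicator_of_mem, weight_addParticles]
    change m ≤ (n.1 + Finsupp.single j m) j
    simp
  · intro n hn
    exact exists_addParticles_eq n (show n ∈ {n : Config (N + m) | m ≤ occ j n} from
      Set.mem_of_indicator_ne_zero hn)

/-- Lift every particle by one level. -/
def shift {N : ℕ} (n : Config N) : Config N :=
  ⟨n.1.embDomain ⟨Nat.succ, Nat.succ_injective⟩, by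
    rw [Finsupp.sum_embDomain]; exact n.2⟩

theorem weight_shift {β δ : ℝ} {ε : ℕ → ℝ} (hε : ∀ j, ε (j + 1) = ε j + δ) {N : ℕ}
    (n : Config N) : weight β ε (shift n) = Real.exp (-(β * δ)) ^ N * weight β ε n := by
  have hN : (N : ℝ) = n.1.sum fun _ k => (k : ℝ) := by
    conv_lhs => rw [← n.2]
    simp [Finsupp.sum]
  have : energy ε (shift n) = energy ε n + N * δ := by
    simp only [energy, shift, Finsupp.sum_embDomain, hN]
    simp only [Finsupp.sum, Finset.sum_mul, ← Finset.sum_add_distrib]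
    refine Finset.sum_congr rfl fun j _ => ?_
    simp only [Function.Embedding.coeFn_mk, Nat.succ_eq_add_one, hε]
    ring
  rw [weight, weight, this, ← Real.exp_nat_mul, ← Real.exp_add]
  ring_nf

/-- `shift` is a bijection onto the event n_0 = 0; equal spacing makes its weight factor depend on N
alone. -/
theorem tsum_indicator_occ_zero {β δ : ℝ} {ε : ℕ → ℝ} (hε : ∀ j, ε (j + 1) = ε j + δ) (N : ℕ) :
    ∑' n : Config N, {n | occ 0 n = 0}.indicator (weight β ε) n
      = Real.exp (-(β * δ)) ^ N * partitionFunction β ε N := by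
  have hinj : Function.Injective (shift : Config N → Config N) := fun n n' h =>
    Subtype.ext (Finsupp.embDomain_injective _ (congrArg Subtype.val h))
  rw [← hinj.tsum_eq, partitionFunction, ← tsum_mul_left]
  · refine tsum_congr fun n => ?_
    rw [Set.indicator_of_mem, weight_shift hε]
    exact Finsupp.embDomain_of_notMem_range _ _ _ (by simp)
  · intro n hn
    have h0 : n.1 0 = 0 := show n ∈ {n : Config N | occ 0 n = 0} from
      Set.mem_of_indicator_ne_zero hn
    have he : (n.1.comapDomain Nat.succ Nat.succ_injective.injOn).embDomain
        ⟨Nat.succ, Nat.succ_injective⟩ = n.1 := by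
      ext j
      cases j with
      | zero => rw [h0]; exact Finsupp.embDomain_of_notMem_range _ _ _ (by simp)
      | succ j =>
        exact (Finsupp.embDomain_apply_self ⟨Nat.succ, Nat.succ_injective⟩ _ j).trans (by simp)
    refine ⟨⟨n.1.comapDomain Nat.succ Nat.succ_injective.injOn, ?_⟩, Subtype.ext he⟩
    have h2 := n.2
    rw [← he, Finsupp.sum_embDomain] at h2
    exact h2

theorem partitionFunction_succ {β δ : ℝ} {ε : ℕ → ℝ}
    (h : Summable fun j => Real.exp (-(β * ε j))) (hε : ∀ j, ε (j + 1) = ε j + δ) (N : ℕ) :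
    Real.exp (-(β * ε 0)) * partitionFunction β ε N
      = (1 - Real.exp (-(β * δ)) ^ (N + 1)) * partitionFunction β ε (N + 1) := by
  have hs := summable_weight h (N + 1)
  have h1 := tsum_indicator_le_occ β ε 0 1 N
  have h2 := tsum_indicator_occ_zero (β := β) hε (N + 1)
  have h3 : partitionFunction β ε (N + 1)
      = ∑' n : Config (N + 1), {n | 1 ≤ occ 0 n}.indicator (weight β ε) n
        + ∑' n : Config (N + 1), {n | occ 0 n = 0}.indicator (weight β ε) n := by
    rw [← (hs.indicator _).tsum_add (hs.indicator _)]
    refine tsum_congr fun n => ?_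
    by_cases hn : occ 0 n = 0
    · simp [hn]
    · simp [hn, Nat.one_le_iff_ne_zero]
  rw [h1, h2] at h3
  simp only [Nat.cast_one, one_mul] at h3
  linarith

/-! ### Exact law and mean of the occupation numbers -/

theorem prob_le_occ {β : ℝ} {ε : ℕ → ℝ} (j : ℕ) {N m : ℕ} (hm : m ≤ N) :
    prob β ε {n : Config N | m ≤ occ j n}
      = Real.exp (-(β * (m * ε j))) * partitionFunction β ε (N - m) / partitionFunction β ε N := by
  obtain ⟨K, rfl⟩ := Nat.exists_eq_add_of_le' hm
  rw [prob, tsum_indicator_le_occ, Nat.add_sub_cancel]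

theorem prob_le_occ_zero {β δ : ℝ} {ε : ℕ → ℝ}
    (h : Summable fun j => Real.exp (-(β * ε j))) (hε : ∀ j, ε (j + 1) = ε j + δ) (N m : ℕ) :
    prob β ε {n : Config N | m ≤ occ 0 n}
      = ∏ i ∈ Finset.range m, (1 - Real.exp (-(β * δ)) ^ (N - i)) := by
  rcases le_or_gt m N with hm | hm
  · rw [prob_le_occ 0 hm, div_eq_iff (partitionFunction_pos h N).ne']
    induction m with
    | zero => simp
    | succ m ih =>
      have ih := ih (by omega)
      have hs := partitionFunction_succ h hε (N - (m + 1))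
      rw [show N - (m + 1) + 1 = N - m by omega] at hs
      have he : Real.exp (-(β * ((m + 1 : ℕ) * ε 0)))
          = Real.exp (-(β * (m * ε 0))) * Real.exp (-(β * ε 0)) := by
        rw [← Real.exp_add]
        push_cast
        ring_nf
      rw [Finset.prod_range_succ, mul_right_comm, ← ih, mul_assoc, mul_comm _ (1 - _), ← hs, he,
        mul_assoc]
  -- For m > N the factor i = N is 1 - q^0 = 0, so the formula needs no restriction on m.
  · rw [Finset.prod_eq_zero (Finset.mem_range.mpr hm) (by simp)]
    have : {n : Config N | m ≤ occ 0 n} = ∅ :=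
      Set.eq_empty_of_forall_notMem fun n hn => absurd (hn.trans (occ_le 0 n)) (by omega)
    simp [prob, this]

/-- Layer-cake formula: n_j counts the m < N with m + 1 ≤ n_j. -/
theorem meanOcc_eq_sum {β : ℝ} {ε : ℕ → ℝ} (h : Summable fun j => Real.exp (-(β * ε j)))
    (N j : ℕ) :
    meanOcc β ε N j = ∑ m ∈ Finset.range N, prob β ε {n : Config N | m + 1 ≤ occ j n} := by
  simp only [meanOcc, mean, prob]
  rw [← Finset.sum_div, ← Summable.tsum_finsetSum fun m _ => (summable_weight h N).indicator _]
  congr 1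
  refine tsum_congr fun n => ?_
  simp only [Set.indicator_apply, Set.mem_ofPred_eq, ← Finset.sum_filter, Finset.sum_const,
    nsmul_eq_mul]
  congr 2
  rw [show (Finset.range N).filter (fun m => m + 1 ≤ occ j n) = Finset.range (occ j n) from ?_,
    Finset.card_range]
  ext m
  have := occ_le j n
  simp only [Finset.mem_filter, Finset.mem_range]
  omega

/-- In the tail formula `prob_le_occ` the level enters only through e^{-βmε_j}, which is largest for
the lowest level. Absence of condensation thereby reduces to a statement about n_0. -/
theorem meanOcc_le_meanOcc_zero {β : ℝ} {ε : ℕ → ℝ} (hβ : 0 ≤ β) (hε : Monotone ε)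
    (h : Summable fun j => Real.exp (-(β * ε j))) (N j : ℕ) :
    meanOcc β ε N j ≤ meanOcc β ε N 0 := by
  rw [meanOcc_eq_sum h, meanOcc_eq_sum h]
  refine Finset.sum_le_sum fun m hm => ?_
  have hm' : m + 1 ≤ N := Finset.mem_range.mp hm
  have hZ := (partitionFunction_pos h N).le
  have hZ' := (partitionFunction_pos h (N - (m + 1))).le
  rw [prob_le_occ j hm', prob_le_occ 0 hm']
  gcongr
  exact hε (Nat.zero_le j)

theorem partitionFunction_eq {β δ : ℝ} {ε : ℕ → ℝ}
    (h : Summable fun j => Real.exp (-(β * ε j))) (hε : ∀ j, ε (j + 1) = ε j + δ)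
    (hδ : 0 < β * δ) (N : ℕ) :
    partitionFunction β ε N
      = Real.exp (-(β * ε 0)) ^ N / ∏ k ∈ Finset.range N, (1 - Real.exp (-(β * δ)) ^ (k + 1)) := by
  have hq : ∀ k : ℕ, 1 - Real.exp (-(β * δ)) ^ (k + 1) ≠ 0 := fun k => by
    have := pow_lt_one₀ (Real.exp_pos (-(β * δ))).le (Real.exp_lt_one_iff.mpr (by linarith)) k.succ_ne_zero
    exact (sub_pos.mpr this).ne'
  induction N with
  | zero => simp [partitionFunction_zero]
  | succ N ih =>
    have hs := partitionFunction_succ h hε N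
    have hP : ∏ k ∈ Finset.range N, (1 - Real.exp (-(β * δ)) ^ (k + 1)) ≠ 0 :=
      Finset.prod_ne_zero_iff.mpr fun k _ => hq k
    rw [Finset.prod_range_succ, eq_div_iff (mul_ne_zero hP (hq N)), mul_comm, mul_assoc, ← hs, ih]
    field_simp
    ring

/-! ### The product and its exponential approximation -/

/-- The canonical probability of at least `m` particles in the ground state, for `N` bosons with
levels of dimensionless spacing `s`. -/
def groundTail (s : ℝ) (N m : ℕ) : ℝ :=
  ∏ i ∈ Finset.range m, (1 - Real.exp (-s) ^ (N - i))

/-- The exponent `∑ exp (-s (N - i))` that governs `groundTail`. -/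
def tailExponent (s : ℝ) (N m : ℕ) : ℝ :=
  ∑ i ∈ Finset.range m, Real.exp (s * i - s * N)

theorem exp_neg_pow_sub (s : ℝ) {N i : ℕ} (h : i ≤ N) :
    Real.exp (-s) ^ (N - i) = Real.exp (s * i - s * N) := by
  rw [← Real.exp_nat_mul, Nat.cast_sub h]
  ring_nf

theorem groundTail_factor_mem {s : ℝ} (hs : 0 ≤ s) (k : ℕ) :
    0 ≤ 1 - Real.exp (-s) ^ k ∧ 1 - Real.exp (-s) ^ k ≤ 1 := by
  have h1 := pow_le_one₀ (n := k) (Real.exp_pos (-s)).le (Real.exp_le_one_iff.mpr (by linarith))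
  have h2 := pow_pos (Real.exp_pos (-s)) k
  constructor <;> linarith

theorem groundTail_nonneg {s : ℝ} (hs : 0 ≤ s) (N m : ℕ) : 0 ≤ groundTail s N m :=
  Finset.prod_nonneg fun _ _ => (groundTail_factor_mem hs _).1

theorem groundTail_antitone {s : ℝ} (hs : 0 ≤ s) (N : ℕ) : Antitone (groundTail s N) := by
  refine antitone_nat_of_succ_le fun m => ?_
  rw [groundTail, Finset.prod_range_succ]
  exact mul_le_of_le_one_right (groundTail_nonneg hs N m) (groundTail_factor_mem hs _).2

theorem groundTail_zero (s : ℝ) (N : ℕ) : groundTail s N 0 = 1 := by simp [groundTail]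

theorem groundTail_le_one {s : ℝ} (hs : 0 ≤ s) (N m : ℕ) : groundTail s N m ≤ 1 :=
  (groundTail_antitone hs N m.zero_le).trans_eq (groundTail_zero s N)

theorem groundTail_of_lt (s : ℝ) {N m : ℕ} (h : N < m) : groundTail s N m = 0 :=
  Finset.prod_eq_zero (Finset.mem_range.mpr h) (by simp)

theorem groundTail_le_exp {s : ℝ} (hs : 0 ≤ s) (N m : ℕ) :
    groundTail s N m ≤ Real.exp (-tailExponent s N m) := by
  rcases lt_or_ge N m with h | h
  · rw [groundTail_of_lt s h]
    exact (Real.exp_pos _).le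
  · rw [groundTail, tailExponent, ← Finset.sum_neg_distrib, Real.exp_sum]
    refine Finset.prod_le_prod (fun _ _ => (groundTail_factor_mem hs _).1) fun i hi => ?_
    rw [exp_neg_pow_sub s ((Finset.mem_range.mp hi).le.trans h)]
    linarith [Real.add_one_le_exp (-Real.exp (s * i - s * N))]

/-- Weierstrass product inequality 1 - ∏(1 - p_i) ≤ Σ p_i. Once m exceeds N the product is already 0
and only the sum grows. -/
theorem one_sub_groundTail_le {s : ℝ} (hs : 0 ≤ s) (N m : ℕ) :
    1 - groundTail s N m ≤ tailExponent s N m := by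
  induction m with
  | zero => simp [groundTail, tailExponent]
  | succ m ih =>
    rcases lt_or_ge N m with h | h
    · have h1 : tailExponent s N m ≤ tailExponent s N (m + 1) := by
        rw [tailExponent, tailExponent, Finset.sum_range_succ]
        linarith [Real.exp_pos (s * m - s * N)]
      rw [groundTail_of_lt s h] at ih
      rw [groundTail_of_lt s (h.trans m.lt_succ_self)]
      linarith
    · rw [tailExponent, Finset.sum_range_succ, ← tailExponent, groundTail, Finset.prod_range_succ,
        ← groundTail, exp_neg_pow_sub s h]
      have := mul_le_of_le_one_left (Real.exp_pos (s * m - s * N)).le (groundTail_le_one hs N m)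
      linarith

/-- From log y ≥ 1 - 1/y at y = 1 - p, which gives -p/(1 - p). -/
theorem exp_neg_div_le_one_sub {p r : ℝ} (hp : 0 ≤ p) (hpr : p ≤ r) (hr : r < 1) :
    Real.exp (-(p / (1 - r))) ≤ 1 - p := by
  have h1 : 0 < 1 - p := by linarith
  rw [← Real.le_log_iff_exp_le h1]
  refine le_trans ?_ (Real.one_sub_inv_le_log_of_pos h1)
  have h2 : 1 - (1 - p)⁻¹ = -(p / (1 - p)) := by
    field_simp
    ring
  rw [h2]
  have : 0 < 1 - r := by linarith
  gcongr

theorem exp_le_groundTail {s : ℝ} (hs : 0 ≤ s) {N m : ℕ} (h : s * m < s * N) :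
    Real.exp (-(tailExponent s N m / (1 - Real.exp (s * m - s * N)))) ≤ groundTail s N m := by
  have hmN : m ≤ N := by
    by_contra! hc
    have : (N : ℝ) ≤ m := by exact_mod_cast hc.le
    exact absurd (mul_le_mul_of_nonneg_left this hs) (not_le.mpr h)
  rw [tailExponent, groundTail, Finset.sum_div, ← Finset.sum_neg_distrib, Real.exp_sum]
  refine Finset.prod_le_prod (fun _ _ => (Real.exp_pos _).le) fun i hi => ?_
  have him := (Finset.mem_range.mp hi).le
  rw [exp_neg_pow_sub s (him.trans hmN)]
  refine exp_neg_div_le_one_sub (Real.exp_pos _).le ?_ (Real.exp_lt_one_iff.mpr (by linarith))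
  gcongr

/-- The geometric sum, left undivided so that s = 0 needs no exception. -/
theorem mul_tailExponent (s : ℝ) (N m : ℕ) :
    (Real.exp s - 1) * tailExponent s N m = Real.exp (s * m - s * N) - Real.exp (-(s * N)) := by
  induction m with
  | zero => simp [tailExponent]
  | succ m ih =>
    rw [tailExponent, Finset.sum_range_succ, ← tailExponent, mul_add, ih, sub_mul, ← Real.exp_add]
    push_cast
    ring_nf

theorem mul_exp_le_tailExponent {s : ℝ} (hs : 0 ≤ s) (N m : ℕ) :
    m * Real.exp (-(s * N)) ≤ tailExponent s N m := by
  rw [tailExponent, ← nsmul_eq_mul, ← Finset.card_range m, ← Finset.sum_const, Finset.card_range]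
  refine Finset.sum_le_sum fun i _ => Real.exp_le_exp.mpr ?_
  have : 0 ≤ s * i := by positivity
  linarith

theorem tailExponent_le_mul_exp {s : ℝ} (hs : 0 ≤ s) (N m : ℕ) :
    tailExponent s N m ≤ m * Real.exp (-(s * N)) * Real.exp (s * m) := by
  rw [mul_assoc, ← Real.exp_add, tailExponent, ← nsmul_eq_mul, ← Finset.card_range m,
    ← Finset.sum_const, Finset.card_range]
  refine Finset.sum_le_sum fun i hi => Real.exp_le_exp.mpr ?_
  have : (i : ℝ) ≤ m := by exact_mod_cast (Finset.mem_range.mp hi).le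
  nlinarith

/-- Squeeze between e^{-L/(1-r)} and e^{-L}, where r = e^{s(m-N)} bounds all the subtracted powers
and tends to 0. -/
theorem tendsto_groundTail {ι : Type*} {l : Filter ι} {s : ι → ℝ} {N m : ι → ℕ} {c : ℝ}
    (hs : ∀ᶠ k in l, 0 ≤ s k)
    (hL : Tendsto (fun k => tailExponent (s k) (N k) (m k)) l (𝓝 c))
    (hm : Tendsto (fun k => s k * m k - s k * N k) l atBot) :
    Tendsto (fun k => groundTail (s k) (N k) (m k)) l (𝓝 (Real.exp (-c))) := by
  have h1 : Tendsto (fun k => Real.exp (s k * m k - s k * N k)) l (𝓝 0) :=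
    Real.tendsto_exp_atBot.comp hm
  have h2 : Tendsto (fun k => Real.exp (-(tailExponent (s k) (N k) (m k)
      / (1 - Real.exp (s k * m k - s k * N k))))) l (𝓝 (Real.exp (-(c / (1 - 0))))) :=
    (Real.continuous_exp.tendsto _).comp (hL.div (h1.const_sub 1) (by norm_num)).neg
  rw [sub_zero, div_one] at h2
  refine tendsto_of_tendsto_of_tendsto_of_le_of_le' h2
    ((Real.continuous_exp.tendsto _).comp hL.neg) ?_ ?_
  · filter_upwards [hs, hm.eventually_lt_atBot 0] with k hk hk'
    exact exp_le_groundTail hk (by linarith)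
  · filter_upwards [hs] with k hk
    exact groundTail_le_exp hk _ _

/-! ### Real thresholds -/

/-- `t ↦ groundTail s N ⌈t⌉₊`, the probability of at least `t` particles in the ground state. -/
def groundTailReal (s : ℝ) (N : ℕ) (t : ℝ) : ℝ := groundTail s N ⌈t⌉₊

theorem groundTailReal_nonneg {s : ℝ} (hs : 0 ≤ s) (N : ℕ) (t : ℝ) : 0 ≤ groundTailReal s N t :=
  groundTail_nonneg hs N _

theorem groundTailReal_le_one {s : ℝ} (hs : 0 ≤ s) (N : ℕ) (t : ℝ) : groundTailReal s N t ≤ 1 :=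
  groundTail_le_one hs N _

theorem groundTailReal_antitone {s : ℝ} (hs : 0 ≤ s) (N : ℕ) : Antitone (groundTailReal s N) :=
  fun _ _ h => groundTail_antitone hs N (Nat.ceil_mono h)

theorem groundTailReal_of_nonpos (s : ℝ) (N : ℕ) {t : ℝ} (ht : t ≤ 0) :
    groundTailReal s N t = 1 := by
  rw [groundTailReal, Nat.ceil_eq_zero.mpr ht, groundTail_zero]

theorem groundTailReal_of_lt (s : ℝ) {N : ℕ} {t : ℝ} (ht : N < t) :
    groundTailReal s N t = 0 :=
  groundTail_of_lt s (Nat.lt_ceil.mpr ht)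

theorem sum_groundTail_eq_integral {s : ℝ} (hs : 0 ≤ s) (N : ℕ) :
    ∑ m ∈ Finset.range N, groundTail s N (m + 1) = ∫ t in Set.Ioc 0 (N : ℝ), groundTailReal s N t := by
  rw [← intervalIntegral.integral_of_le N.cast_nonneg]
  have h := intervalIntegral.sum_integral_adjacent_intervals (μ := volume)
    (f := groundTailReal s N) (a := fun k : ℕ => (k : ℝ)) (n := N)
    fun k _ => (groundTailReal_antitone hs N).intervalIntegrable
  rw [Nat.cast_zero] at h
  rw [← h]
  refine Finset.sum_congr rfl fun m _ => ?_
  rw [intervalIntegral.integral_of_le (by simp),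
    setIntegral_congr_fun (g := fun _ => groundTail s N (m + 1)) measurableSet_Ioc]
  · simp
  · intro t ht
    have : ⌈t⌉₊ = m + 1 := (Nat.ceil_eq_iff m.succ_ne_zero).mpr ⟨by simpa using ht.1, by simpa using ht.2⟩
    simp only [groundTailReal, this]

/-! ### The scaled trap -/

/-- The dimensionless level spacing in the scaled trap. -/
def trapSpacing (a : ℝ) (N : ℕ) : ℝ := a * (Real.log N / N)

theorem trapSpacing_pos {a : ℝ} (ha : 0 < a) {N : ℕ} (hN : 2 ≤ N) : 0 < trapSpacing a N := by
  have h1 : (1 : ℝ) < N := by exact_mod_cast hN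
  have := Real.log_pos h1
  unfold trapSpacing
  positivity

theorem trapSpacing_nonneg {a : ℝ} (ha : 0 < a) (N : ℕ) : 0 ≤ trapSpacing a N :=
  mul_nonneg ha.le (div_nonneg (Real.log_natCast_nonneg N) N.cast_nonneg)

theorem trapSpacing_mul {a : ℝ} {N : ℕ} (hN : N ≠ 0) : trapSpacing a N * N = a * Real.log N := by
  have : (N : ℝ) ≠ 0 := by exact_mod_cast hN
  unfold trapSpacing
  field_simp

theorem exp_neg_trapSpacing_mul {a : ℝ} {N : ℕ} (hN : N ≠ 0) :
    Real.exp (-(trapSpacing a N * N)) = (N : ℝ) ^ (-a) := by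
  have : (0 : ℝ) < N := by exact_mod_cast Nat.pos_of_ne_zero hN
  rw [trapSpacing_mul hN, Real.rpow_def_of_pos this]
  ring_nf

theorem tendsto_log_div_natCast :
    Tendsto (fun N : ℕ => Real.log N / N) atTop (𝓝 0) := by
  have h := (Real.isLittleO_log_id_atTop).tendsto_div_nhds_zero
  exact h.comp tendsto_natCast_atTop_atTop

theorem tendsto_trapSpacing (a : ℝ) : Tendsto (trapSpacing a) atTop (𝓝 0) := by
  have h := tendsto_log_div_natCast.const_mul a
  rwa [mul_zero] at h

section Trap

variable {hbar ω β a : ℝ}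

theorem trapLevel_succ (N j : ℕ) :
    trapLevel hbar ω N (j + 1) = trapLevel hbar ω N j + hbar * (ω * (Real.log N / N)) := by
  simp only [trapLevel, oscillatorLevel]
  push_cast
  ring

theorem mul_trapLevel_zero (ha : a = hbar * ω * β) (N : ℕ) :
    β * trapLevel hbar ω N 0 = trapSpacing a N / 2 := by
  simp only [trapLevel, oscillatorLevel, trapSpacing, ha]
  push_cast
  ring

theorem mul_trapSpacing (ha : a = hbar * ω * β) (N : ℕ) :
    β * (hbar * (ω * (Real.log N / N))) = trapSpacing a N := by
  simp only [trapSpacing, ha]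
  ring

theorem summable_trap (ha : a = hbar * ω * β) (ha0 : 0 < a) {N : ℕ} (hN : 2 ≤ N) :
    Summable fun j => Real.exp (-(β * trapLevel hbar ω N j)) := by
  have hq : Real.exp (-trapSpacing a N) < 1 :=
    Real.exp_lt_one_iff.mpr (by linarith [trapSpacing_pos ha0 hN])
  refine ((summable_geometric_of_lt_one (Real.exp_pos _).le hq).mul_left
    (Real.exp (-(trapSpacing a N / 2)))).congr fun j => ?_
  rw [← Real.exp_nat_mul, ← Real.exp_add]
  simp only [trapLevel, oscillatorLevel, trapSpacing, ha]
  ring_nf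

theorem groundProb_le_occ (ha : a = hbar * ω * β) (ha0 : 0 < a) {N : ℕ} (hN : 2 ≤ N)
    (S : ℝ → Prop) (t : ℝ) (hS : ∀ n₀ : ℕ, S n₀ ↔ t ≤ n₀) :
    groundProb hbar ω β N S = groundTailReal (trapSpacing a N) N t := by
  have hset : {n : Config N | S (occ 0 n : ℝ)} = {n : Config N | ⌈t⌉₊ ≤ occ 0 n} := by
    ext n
    simp [hS]
  rw [groundProb, hset, prob_le_occ_zero (summable_trap ha ha0 hN) (trapLevel_succ N),
    mul_trapSpacing ha]
  rfl

theorem trapMeanOcc_zero (ha : a = hbar * ω * β) (ha0 : 0 < a) {N : ℕ} (hN : 2 ≤ N) :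
    trapMeanOcc hbar ω β N 0
      = ∫ t in Set.Ioc 0 (N : ℝ), groundTailReal (trapSpacing a N) N t := by
  rw [trapMeanOcc, meanOcc_eq_sum (summable_trap ha ha0 hN),
    ← sum_groundTail_eq_integral (trapSpacing_nonneg ha0 N)]
  refine Finset.sum_congr rfl fun m _ => ?_
  rw [prob_le_occ_zero (summable_trap ha ha0 hN) (trapLevel_succ N), mul_trapSpacing ha]
  rfl

theorem trapMeanOcc_le (hhbar : 0 < hbar) (hω : 0 < ω) (hβ : 0 < β) (N : ℕ) (hN : 2 ≤ N) (j : ℕ) :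
    trapMeanOcc hbar ω β N j ≤ trapMeanOcc hbar ω β N 0 := by
  refine meanOcc_le_meanOcc_zero hβ.le (monotone_nat_of_le_succ fun k => ?_)
    (summable_trap rfl (by positivity) hN) N j
  rw [trapLevel_succ]
  have := Real.log_natCast_nonneg N
  have : 0 ≤ hbar * (ω * (Real.log N / N)) := by positivity
  linarith

end Trap

/-! ### Exponential law for a < 1 -/

theorem tendsto_log_natCast : Tendsto (fun N : ℕ => Real.log N) atTop atTop :=
  Real.tendsto_log_atTop.comp tendsto_natCast_atTop_atTop

theorem tendsto_exp_sub_one_div {s : ℕ → ℝ} (hs : Tendsto s atTop (𝓝 0))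
    (hs0 : ∀ᶠ k in atTop, 0 < s k) :
    Tendsto (fun k => (Real.exp (s k) - 1) / s k) atTop (𝓝 1) := by
  have h := (hasDerivAt_iff_tendsto_slope.mp (Real.hasDerivAt_exp 0)).comp
    (tendsto_nhdsWithin_iff.mpr ⟨hs, hs0.mono fun k hk => hk.ne'⟩)
  rw [Real.exp_zero] at h
  refine h.congr fun k => ?_
  simp [slope_def_field]

/-- Each term of the exponent is at least N^{-a}. The bound holds for every N ≥ 2, so it also
provides the dominating function for the mean. -/
theorem le_tailExponent_rpow {a : ℝ} (ha : 0 < a) {N : ℕ} (hN : 2 ≤ N) (x : ℝ) :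
    x ≤ tailExponent (trapSpacing a N) N ⌈x * (N : ℝ) ^ a⌉₊ := by
  refine le_trans ?_ (mul_exp_le_tailExponent (trapSpacing_nonneg ha N) N _)
  have hN0 : (0 : ℝ) < N := by exact_mod_cast (by omega : 0 < N)
  rw [exp_neg_trapSpacing_mul (by omega), Real.rpow_neg hN0.le, ← div_eq_mul_inv,
    le_div_iff₀ (by positivity)]
  exact Nat.le_ceil _

theorem tendsto_groundTailReal_rpow {a x : ℝ} (ha : 0 < a) (ha1 : a < 1) (hx : 0 ≤ x) :
    Tendsto (fun N : ℕ => groundTailReal (trapSpacing a N) N (x * (N : ℝ) ^ a)) atTop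
      (𝓝 (Real.exp (-x))) := by
  have hpow : Tendsto (fun N : ℕ => (N : ℝ) ^ (-a)) atTop (𝓝 0) :=
    (tendsto_rpow_neg_atTop ha).comp tendsto_natCast_atTop_atTop
  have hlog : Tendsto (fun N : ℕ => Real.log N * (N : ℝ) ^ (a - 1)) atTop (𝓝 0) := by
    have h := (isLittleO_log_rpow_atTop (show 0 < 1 - a by linarith)).tendsto_div_nhds_zero.comp
      tendsto_natCast_atTop_atTop
    refine h.congr fun N => ?_
    simp only [Function.comp_apply]
    rw [div_eq_mul_inv, ← Real.rpow_neg N.cast_nonneg, neg_sub]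
  -- s m is at most a x N^{a-1} log N + s, which vanishes because a < 1; so the terms of the
  -- exponent are asymptotically equal.
  have hsm : Tendsto (fun N : ℕ => trapSpacing a N * ⌈x * (N : ℝ) ^ a⌉₊) atTop (𝓝 0) := by
    have h1 : Tendsto (fun N : ℕ => a * x * (Real.log N * (N : ℝ) ^ (a - 1)) + trapSpacing a N)
        atTop (𝓝 0) := by
      simpa using (hlog.const_mul (a * x)).add (tendsto_trapSpacing a)
    refine squeeze_zero' (Eventually.of_forall fun N =>
      mul_nonneg (trapSpacing_nonneg ha N) (Nat.cast_nonneg _)) ?_ h1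
    filter_upwards [eventually_ge_atTop 2] with N hN
    have hN0 : (0 : ℝ) < N := by exact_mod_cast (by omega : 0 < N)
    have hc : (⌈x * (N : ℝ) ^ a⌉₊ : ℝ) ≤ x * (N : ℝ) ^ a + 1 := (Nat.ceil_lt_add_one (by positivity)).le
    refine (mul_le_mul_of_nonneg_left hc (trapSpacing_nonneg ha N)).trans_eq ?_
    rw [Real.rpow_sub_one hN0.ne']
    simp only [trapSpacing]
    ring
  refine tendsto_groundTail (Eventually.of_forall fun N => trapSpacing_nonneg ha N) ?_ ?_
  · have h2 : Tendsto (fun N : ℕ => (x + (N : ℝ) ^ (-a))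
        * Real.exp (trapSpacing a N * ⌈x * (N : ℝ) ^ a⌉₊)) atTop (𝓝 ((x + 0) * Real.exp 0)) :=
      (hpow.const_add x).mul ((Real.continuous_exp.tendsto _).comp hsm)
    rw [add_zero, Real.exp_zero, mul_one] at h2
    refine tendsto_of_tendsto_of_tendsto_of_le_of_le' tendsto_const_nhds h2 ?_ ?_
    · filter_upwards [eventually_ge_atTop 2] with N hN
      exact le_tailExponent_rpow ha hN x
    · filter_upwards [eventually_ge_atTop 2] with N hN
      have hN0 : (0 : ℝ) < N := by exact_mod_cast (by omega : 0 < N)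
      refine (tailExponent_le_mul_exp (trapSpacing_nonneg ha N) N _).trans ?_
      refine mul_le_mul_of_nonneg_right ?_ (Real.exp_pos _).le
      have hc : (⌈x * (N : ℝ) ^ a⌉₊ : ℝ) ≤ x * (N : ℝ) ^ a + 1 :=
        (Nat.ceil_lt_add_one (by positivity)).le
      rw [exp_neg_trapSpacing_mul (by omega)]
      refine (mul_le_mul_of_nonneg_right hc (by positivity)).trans_eq ?_
      rw [add_mul, mul_assoc, ← Real.rpow_add hN0, add_neg_cancel, Real.rpow_zero]
      ring
  · have h3 : Tendsto (fun N : ℕ => a * Real.log N) atTop atTop :=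
      tendsto_log_natCast.const_mul_atTop ha
    have h4 := (tendsto_neg_atTop_atBot.comp h3)
    refine (hsm.add_atBot h4).congr' ?_
    filter_upwards [eventually_ge_atTop 2] with N hN
    rw [trapSpacing_mul (by omega)]
    simp only [Function.comp_apply]
    ring

/-! ### Gumbel law and concentration for a ≥ 1 -/

/-- The ground-state occupation number `(1 - 1/a) N + (N / log N) ((log log N) / a + x)` on the
scale of the Gumbel law. -/
def gumbelThreshold (a : ℝ) (N : ℕ) (x : ℝ) : ℝ :=
  (1 - a⁻¹) * N + N / Real.log N * (a⁻¹ * Real.log (Real.log N) + x)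

theorem log_natCast_pos {N : ℕ} (hN : 2 ≤ N) : 0 < Real.log N :=
  Real.log_pos (by exact_mod_cast hN)

theorem trapSpacing_mul_gumbelThreshold {a : ℝ} (ha : 0 < a) {N : ℕ} (hN : 2 ≤ N) (x : ℝ) :
    trapSpacing a N * gumbelThreshold a N x - trapSpacing a N * N
      = Real.log (Real.log N / N) + a * x := by
  have hN0 : (0 : ℝ) < N := by exact_mod_cast (by omega : 0 < N)
  have hl := log_natCast_pos hN
  rw [Real.log_div hl.ne' hN0.ne', trapSpacing, gumbelThreshold]
  field_simp
  ring

theorem exp_trapSpacing_mul_gumbelThreshold {a : ℝ} (ha : 0 < a) {N : ℕ} (hN : 2 ≤ N) (x : ℝ) :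
    Real.exp (trapSpacing a N * gumbelThreshold a N x - trapSpacing a N * N)
      = Real.log N / N * Real.exp (a * x) := by
  have hN0 : (0 : ℝ) < N := by exact_mod_cast (by omega : 0 < N)
  have hl := log_natCast_pos hN
  rw [trapSpacing_mul_gumbelThreshold ha hN, Real.exp_add, Real.exp_log (by positivity)]

/-- At a = 1 the linear term vanishes, and positivity comes from log log N → ∞. -/
theorem eventually_gumbelThreshold_nonneg {a : ℝ} (ha : 1 ≤ a) {x : ℕ → ℝ} {x₀ : ℝ}
    (hx : Tendsto x atTop (𝓝 x₀)) : ∀ᶠ N : ℕ in atTop, 0 ≤ gumbelThreshold a N (x N) := by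
  have ha0 : 0 < a := by linarith
  have h : Tendsto (fun N : ℕ => a⁻¹ * Real.log (Real.log N) + x N) atTop atTop :=
    ((Real.tendsto_log_atTop.comp tendsto_log_natCast).const_mul_atTop (by positivity)).atTop_add hx
  filter_upwards [h.eventually_ge_atTop 0] with N hN
  have h1 : 0 ≤ 1 - a⁻¹ := sub_nonneg.mpr (inv_le_one_of_one_le₀ ha)
  have h2 := Real.log_natCast_nonneg N
  unfold gumbelThreshold
  positivity

/-- The argument x may vary with N: this is what allows centring at the mean, whose position on the
Gumbel scale is known only in the limit. -/
theorem tendsto_groundTailReal_gumbel {a : ℝ} (ha : 1 ≤ a) {x : ℕ → ℝ} {x₀ : ℝ}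
    (hx : Tendsto x atTop (𝓝 x₀)) :
    Tendsto (fun N : ℕ => groundTailReal (trapSpacing a N) N (gumbelThreshold a N (x N))) atTop
      (𝓝 (Real.exp (-(a⁻¹ * Real.exp (a * x₀))))) := by
  have ha0 : 0 < a := by linarith
  -- The effect of rounding the threshold up, at most one spacing.
  set θ : ℕ → ℝ := fun N => trapSpacing a N *
    (⌈gumbelThreshold a N (x N)⌉₊ - gumbelThreshold a N (x N)) with hθdef
  have hθ : Tendsto θ atTop (𝓝 0) := by
    refine squeeze_zero' ?_ ?_ (tendsto_trapSpacing a)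
    · filter_upwards with N
      exact mul_nonneg (trapSpacing_nonneg ha0 N) (sub_nonneg.mpr (Nat.le_ceil _))
    · filter_upwards [eventually_gumbelThreshold_nonneg ha hx] with N hN
      refine mul_le_of_le_one_right (trapSpacing_nonneg ha0 N) ?_
      linarith [Nat.ceil_lt_add_one hN]
  have hsm : ∀ N : ℕ, 2 ≤ N → trapSpacing a N * ⌈gumbelThreshold a N (x N)⌉₊ - trapSpacing a N * N
      = Real.log (Real.log N / N) + (a * x N + θ N) := by
    intro N hN
    rw [← add_assoc, ← trapSpacing_mul_gumbelThreshold ha0 hN]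
    simp only [hθdef]
    ring
  refine tendsto_groundTail (Eventually.of_forall fun N => trapSpacing_nonneg ha0 N) ?_ ?_
  · have hs0 : ∀ᶠ N : ℕ in atTop, 0 < trapSpacing a N :=
      (eventually_ge_atTop 2).mono fun N hN => trapSpacing_pos ha0 hN
    have h1 := tendsto_exp_sub_one_div (tendsto_trapSpacing a) hs0
    have h2 : Tendsto (fun N : ℕ => Real.exp (a * x N + θ N)) atTop (𝓝 (Real.exp (a * x₀))) := by
      refine (Real.continuous_exp.tendsto _).comp ?_
      simpa using (hx.const_mul a).add hθ
    -- The lower end of the geometric sum contributes N^{-a}/s, a multiple of this; at a = 1 only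
    -- the logarithm makes it vanish.
    have h3 : Tendsto (fun N : ℕ => (N : ℝ) ^ (1 - a) / Real.log N) atTop (𝓝 0) := by
      refine squeeze_zero' ?_ ?_ (tendsto_inv_atTop_zero.comp tendsto_log_natCast)
      · filter_upwards with N
        have := Real.log_natCast_nonneg N
        positivity
      · filter_upwards [eventually_ge_atTop 2] with N hN
        have hl := log_natCast_pos hN
        rw [Function.comp_apply, ← one_div]
        gcongr
        exact Real.rpow_le_one_of_one_le_of_nonpos (by exact_mod_cast (by omega : 1 ≤ N))
          (by linarith)
    have h4 := ((h2.sub h3).div h1 one_ne_zero).const_mul a⁻¹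
    rw [sub_zero, div_one] at h4
    refine h4.congr' ?_
    filter_upwards [eventually_ge_atTop 2] with N hN
    have hN0 : (0 : ℝ) < N := by exact_mod_cast (by omega : 0 < N)
    have hl := log_natCast_pos hN
    have hs := trapSpacing_pos ha0 hN
    have he : 0 < Real.exp (trapSpacing a N) - 1 := by
      linarith [Real.add_one_lt_exp hs.ne']
    have hm := mul_tailExponent (trapSpacing a N) N ⌈gumbelThreshold a N (x N)⌉₊
    rw [hsm N hN, Real.exp_add, Real.exp_log (by positivity),
      exp_neg_trapSpacing_mul (by omega)] at hm
    rw [mul_comm, ← eq_div_iff he.ne'] at hm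
    simp only [Pi.div_apply]
    rw [hm, show (N : ℝ) ^ (1 - a) = N * (N : ℝ) ^ (-a) by
      rw [sub_eq_add_neg, Real.rpow_add hN0, Real.rpow_one]]
    rw [show trapSpacing a N = a * (Real.log N / N) from rfl] at he ⊢
    field_simp
  · have h1 : Tendsto (fun N : ℕ => Real.log (Real.log N / N)) atTop atBot := by
      refine Real.tendsto_log_nhdsGT_zero.comp (tendsto_nhdsWithin_iff.mpr
        ⟨tendsto_log_div_natCast, ?_⟩)
      filter_upwards [eventually_ge_atTop 2] with N hN
      have hN0 : (0 : ℝ) < N := by exact_mod_cast (by omega : 0 < N)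
      exact div_pos (log_natCast_pos hN) hN0
    refine (h1.atBot_add ((hx.const_mul a).add hθ)).congr' ?_
    filter_upwards [eventually_ge_atTop 2] with N hN
    exact (hsm N hN).symm

theorem tendsto_gumbelThreshold_div (a x : ℝ) :
    Tendsto (fun N : ℕ => gumbelThreshold a N x / N) atTop (𝓝 (1 - a⁻¹)) := by
  have h1 : Tendsto (fun N : ℕ => Real.log (Real.log N) / Real.log N) atTop (𝓝 0) :=
    (Real.isLittleO_log_id_atTop).tendsto_div_nhds_zero.comp tendsto_log_natCast
  have h2 : Tendsto (fun N : ℕ => (Real.log N)⁻¹) atTop (𝓝 0) :=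
    tendsto_inv_atTop_zero.comp tendsto_log_natCast
  have h3 := ((h1.const_mul a⁻¹).add (h2.const_mul x)).const_add (1 - a⁻¹)
  simp only [mul_zero, add_zero] at h3
  refine h3.congr' ?_
  filter_upwards [eventually_ge_atTop 2] with N hN
  have hN0 : (0 : ℝ) < N := by exact_mod_cast (by omega : 0 < N)
  have hl := log_natCast_pos hN
  rw [gumbelThreshold]
  field_simp

/-- For fixed x the Gumbel threshold is (1 - a^{-1} + o(1))N, hence eventually above l_N N.
Monotonicity of the tail bounds the probability below by a value near the Gumbel tail at x, itself
near 1 for x very negative. -/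
theorem tendsto_groundTailReal_of_lt {a l₀ : ℝ} (ha : 1 ≤ a) {l : ℕ → ℝ}
    (hl : Tendsto l atTop (𝓝 l₀)) (h : l₀ < 1 - a⁻¹) :
    Tendsto (fun N : ℕ => groundTailReal (trapSpacing a N) N (l N * N)) atTop (𝓝 1) := by
  have ha0 : 0 < a := by linarith
  rw [tendsto_order]
  refine ⟨fun b hb => ?_, fun b hb => Eventually.of_forall fun N =>
    (groundTailReal_le_one (trapSpacing_nonneg ha0 N) N _).trans_lt hb⟩
  have hG : Tendsto (fun x : ℝ => Real.exp (-(a⁻¹ * Real.exp (a * x)))) atBot (𝓝 1) := by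
    have h1 : Tendsto (fun x : ℝ => Real.exp (a * x)) atBot (𝓝 0) :=
      Real.tendsto_exp_atBot.comp (tendsto_id.const_mul_atBot ha0)
    have h2 := (Real.continuous_exp.tendsto _).comp (h1.const_mul a⁻¹).neg
    rwa [mul_zero, neg_zero, Real.exp_zero] at h2
  obtain ⟨x, hx⟩ := (hG.eventually (lt_mem_nhds hb)).exists
  filter_upwards [(tendsto_groundTailReal_gumbel ha (tendsto_const_nhds (x := x))).eventually
    (lt_mem_nhds hx), hl.eventually_lt (tendsto_gumbelThreshold_div a x) h,
    eventually_ge_atTop 2] with N h1 h2 hN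
  have hN0 : (0 : ℝ) < N := by exact_mod_cast (by omega : 0 < N)
  refine h1.trans_le (groundTailReal_antitone (trapSpacing_nonneg ha0 N) N ?_)
  exact ((lt_div_iff₀ hN0).mp h2).le

theorem tendsto_groundTailReal_of_gt {a l₀ : ℝ} (ha : 1 ≤ a) {l : ℕ → ℝ}
    (hl : Tendsto l atTop (𝓝 l₀)) (h : 1 - a⁻¹ < l₀) :
    Tendsto (fun N : ℕ => groundTailReal (trapSpacing a N) N (l N * N)) atTop (𝓝 0) := by
  have ha0 : 0 < a := by linarith
  rw [tendsto_order]
  refine ⟨fun b hb => Eventually.of_forall fun N =>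
    hb.trans_le (groundTailReal_nonneg (trapSpacing_nonneg ha0 N) N _), fun b hb => ?_⟩
  have hG : Tendsto (fun x : ℝ => Real.exp (-(a⁻¹ * Real.exp (a * x)))) atTop (𝓝 0) := by
    have h1 : Tendsto (fun x : ℝ => Real.exp (a * x)) atTop atTop :=
      Real.tendsto_exp_atTop.comp (tendsto_id.const_mul_atTop ha0)
    exact Real.tendsto_exp_neg_atTop_nhds_zero.comp (h1.const_mul_atTop (by positivity))
  obtain ⟨x, hx⟩ := (hG.eventually (gt_mem_nhds hb)).exists
  filter_upwards [(tendsto_groundTailReal_gumbel ha (tendsto_const_nhds (x := x))).eventually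
    (gt_mem_nhds hx), (tendsto_gumbelThreshold_div a x).eventually_lt hl h,
    eventually_ge_atTop 2] with N h1 h2 hN
  have hN0 : (0 : ℝ) < N := by exact_mod_cast (by omega : 0 < N)
  refine (groundTailReal_antitone (trapSpacing_nonneg ha0 N) N ?_).trans_lt h1
  exact ((div_lt_iff₀ hN0).mp h2).le

/-! ### The limiting Gumbel law and its mean -/

theorem integrable_exp_neg_mul_abs {b : ℝ} (hb : 0 < b) :
    Integrable fun x : ℝ => Real.exp (-(b * |x|)) := by
  rw [← integrableOn_univ, ← Set.Iic_union_Ioi (a := (0 : ℝ))]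
  refine IntegrableOn.union ?_ ?_
  · refine (integrableOn_exp_mul_Iic hb 0).congr_fun (fun x hx => ?_) measurableSet_Iic
    simp only
    rw [abs_of_nonpos hx, mul_neg, neg_neg]
  · refine (integrableOn_exp_mul_Ioi (neg_lt_zero.mpr hb) 0).congr_fun (fun x hx => ?_)
      measurableSet_Ioi
    simp only
    rw [abs_of_pos hx, neg_mul]

/-- The density of the limiting Gumbel law times `x` is integrable. -/
theorem integrable_mul_gumbel_density {a : ℝ} (ha : 0 < a) :
    Integrable fun x : ℝ => x * Real.exp (a * x - a⁻¹ * Real.exp (a * x)) := by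
  refine ((integrable_exp_neg_mul_abs (half_pos ha)).const_mul
    (2 / a * (1 + 6 * a ^ 3))).mono' ?_ (Eventually.of_forall fun x => ?_)
  · exact Continuous.aestronglyMeasurable (by fun_prop)
  -- The factor |x| costs half of the decay rate a.
  have h1 : |x| ≤ 2 / a * Real.exp (a / 2 * |x|) := by
    rw [div_mul_eq_mul_div, le_div_iff₀ ha]
    linarith [Real.add_one_le_exp (a / 2 * |x|)]
  have h2 : Real.exp (a * x - a⁻¹ * Real.exp (a * x))
      ≤ (1 + 6 * a ^ 3) * Real.exp (-(a * |x|)) := by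
    rcases le_or_gt x 0 with hx | hx
    · rw [abs_of_nonpos hx, mul_neg, neg_neg]
      have : Real.exp (a * x - a⁻¹ * Real.exp (a * x)) ≤ 1 * Real.exp (a * x) := by
        rw [one_mul]
        apply Real.exp_le_exp.mpr
        have : 0 < a⁻¹ * Real.exp (a * x) := by positivity
        linarith
      refine this.trans ?_
      gcongr
      have : 0 < a ^ 3 := by positivity
      linarith
    · rw [abs_of_pos hx]
      set u := Real.exp (a * x) with hu
      have hu1 : 1 ≤ u := Real.one_le_exp (by positivity)
      have hu0 : 0 < u := by linarith
      -- The cubic term of the exponential series gives u e^{-u/a} ≤ 6a³u^{-2} ≤ 6a³u^{-1}, whence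
      -- the constant 6a³.
      have h3 : (a⁻¹ * u) ^ 3 / 6 ≤ Real.exp (a⁻¹ * u) := by
        have := Real.pow_div_factorial_le_exp (a⁻¹ * u) (by positivity) 3
        norm_num [Nat.factorial] at this ⊢
        linarith
      rw [Real.exp_sub, ← hu, Real.exp_neg, ← hu, div_le_iff₀ (Real.exp_pos _)]
      calc u = 6 * a ^ 3 * u⁻¹ * u⁻¹ * ((a⁻¹ * u) ^ 3 / 6) := by field_simp
        _ ≤ 6 * a ^ 3 * u⁻¹ * 1 * Real.exp (a⁻¹ * u) := by
          have : u⁻¹ ≤ 1 := inv_le_one_of_one_le₀ hu1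
          gcongr
        _ ≤ (1 + 6 * a ^ 3) * u⁻¹ * Real.exp (a⁻¹ * u) := by
          rw [mul_one]
          gcongr
          linarith
  rw [norm_mul, Real.norm_eq_abs, Real.norm_of_nonneg (Real.exp_pos _).le]
  calc |x| * Real.exp (a * x - a⁻¹ * Real.exp (a * x))
      ≤ 2 / a * Real.exp (a / 2 * |x|) * ((1 + 6 * a ^ 3) * Real.exp (-(a * |x|))) := by gcongr
    _ = 2 / a * (1 + 6 * a ^ 3) * (Real.exp (a / 2 * |x|) * Real.exp (-(a * |x|))) := by ring
    _ = _ := by rw [← Real.exp_add]; ring_nf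

/-- The upper tail of the limiting Gumbel law. -/
def gumbelTail (a x : ℝ) : ℝ := Real.exp (-(a⁻¹ * Real.exp (a * x)))

theorem gumbelTail_le_exp_neg {a : ℝ} (ha : 0 < a) (x : ℝ) : gumbelTail a x ≤ Real.exp (-x) := by
  refine Real.exp_le_exp.mpr (neg_le_neg ?_)
  rw [inv_mul_eq_div, le_div_iff₀ ha]
  linarith [Real.add_one_le_exp (a * x)]

theorem one_sub_gumbelTail_le (a x : ℝ) : 1 - gumbelTail a x ≤ a⁻¹ * Real.exp (a * x) := by
  linarith [Real.add_one_le_exp (-(a⁻¹ * Real.exp (a * x))), gumbelTail.eq_1 a x]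

theorem gumbelTail_le_one {a : ℝ} (ha : 0 < a) (x : ℝ) : gumbelTail a x ≤ 1 :=
  Real.exp_le_one_iff.mpr (neg_nonpos.mpr (by positivity))

theorem continuous_gumbelTail (a : ℝ) : Continuous (gumbelTail a) := by
  unfold gumbelTail
  fun_prop

theorem hasDerivAt_gumbelTail {a : ℝ} (ha : 0 < a) (x : ℝ) :
    HasDerivAt (gumbelTail a) (-Real.exp (a * x - a⁻¹ * Real.exp (a * x))) x := by
  have h := ((((hasDerivAt_id x).const_mul a).exp.const_mul a⁻¹).neg).exp
  refine h.congr_deriv ?_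
  simp only [id, Pi.neg_apply]
  rw [sub_eq_add_neg, Real.exp_add]
  field_simp

/-- Antiderivative for the integration by parts: c = 0 is used on the positive half-line and c = 1
on the negative one, so that the boundary terms vanish. -/
theorem hasDerivAt_mul_gumbelTail_sub {a : ℝ} (ha : 0 < a) (c x : ℝ) :
    HasDerivAt (fun x => x * (gumbelTail a x - c))
      ((gumbelTail a x - c) - x * Real.exp (a * x - a⁻¹ * Real.exp (a * x))) x := by
  refine ((hasDerivAt_id x).mul ((hasDerivAt_gumbelTail ha x).sub_const c)).congr_deriv ?_
  simp only [id]
  ring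

theorem integrableOn_gumbelTail_Ioi {a : ℝ} (ha : 0 < a) :
    IntegrableOn (gumbelTail a) (Set.Ioi 0) := by
  refine Integrable.mono' (exp_neg_integrableOn_Ioi 0 one_pos)
    (continuous_gumbelTail a).aestronglyMeasurable (Eventually.of_forall fun x => ?_)
  rw [Real.norm_of_nonneg (show 0 ≤ gumbelTail a x from (Real.exp_pos _).le), neg_one_mul]
  exact gumbelTail_le_exp_neg ha x

theorem integrableOn_gumbelTail_sub_one_Iic {a : ℝ} (ha : 0 < a) :
    IntegrableOn (fun x => gumbelTail a x - 1) (Set.Iic 0) := by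
  refine Integrable.mono' ((integrableOn_exp_mul_Iic ha 0).const_mul a⁻¹)
    ((continuous_gumbelTail a).sub continuous_const).aestronglyMeasurable
    (Eventually.of_forall fun x => ?_)
  rw [Real.norm_of_nonpos (by linarith [gumbelTail_le_one ha x])]
  linarith [one_sub_gumbelTail_le a x]

theorem integral_gumbelTail_Ioi {a : ℝ} (ha : 0 < a) :
    ∫ x in Set.Ioi 0, gumbelTail a x
      = ∫ x in Set.Ioi 0, x * Real.exp (a * x - a⁻¹ * Real.exp (a * x)) := by
  have hlim : Tendsto (fun x => x * (gumbelTail a x - 0)) atTop (𝓝 0) := by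
    have h := Real.tendsto_pow_mul_exp_neg_atTop_nhds_zero 1
    refine squeeze_zero' ?_ ?_ h
    · filter_upwards [eventually_ge_atTop 0] with x hx
      rw [sub_zero]
      exact mul_nonneg hx (Real.exp_pos _).le
    · filter_upwards [eventually_ge_atTop 0] with x hx
      rw [sub_zero, pow_one]
      exact mul_le_mul_of_nonneg_left (gumbelTail_le_exp_neg ha x) hx
  have hi := integrableOn_gumbelTail_Ioi ha
  have hi' := (integrable_mul_gumbel_density ha).integrableOn (s := Set.Ioi 0)
  have h := integral_Ioi_of_hasDerivAt_of_tendsto' (a := 0) (m := 0)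
    (fun x _ => hasDerivAt_mul_gumbelTail_sub ha 0 x) (by simp only [sub_zero]; exact hi.sub hi') hlim
  simp only [sub_zero, zero_mul] at h
  rw [integral_sub hi hi'] at h
  linarith

theorem integral_gumbelTail_sub_one_Iic {a : ℝ} (ha : 0 < a) :
    ∫ x in Set.Iic 0, (gumbelTail a x - 1)
      = ∫ x in Set.Iic 0, x * Real.exp (a * x - a⁻¹ * Real.exp (a * x)) := by
  have hlim : Tendsto (fun x => x * (gumbelTail a x - 1)) atBot (𝓝 0) := by
    have h := ((Real.tendsto_pow_mul_exp_neg_atTop_nhds_zero 1).comp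
      (tendsto_neg_atBot_atTop.const_mul_atTop ha)).const_mul (a⁻¹ * a⁻¹)
    rw [mul_zero] at h
    refine squeeze_zero' ?_ ?_ h
    · filter_upwards [eventually_le_atBot 0] with x hx
      exact mul_nonneg_of_nonpos_of_nonpos hx (by linarith [gumbelTail_le_one ha x])
    · filter_upwards [eventually_le_atBot 0] with x hx
      have := mul_le_mul_of_nonneg_left (one_sub_gumbelTail_le a x) (neg_nonneg.mpr hx)
      simp only [Function.comp_apply, pow_one, mul_neg, neg_neg]
      field_simp at this ⊢
      linarith
  have hi := integrableOn_gumbelTail_sub_one_Iic ha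
  have hi' := (integrable_mul_gumbel_density ha).integrableOn (s := Set.Iic 0)
  have h := integral_Iic_of_hasDerivAt_of_tendsto' (a := 0) (m := 0)
    (fun x _ => hasDerivAt_mul_gumbelTail_sub ha 1 x) (hi.sub hi') hlim
  simp only [zero_mul, sub_zero] at h
  rw [integral_sub hi hi'] at h
  linarith

/-- The indicator of the negative half-line, the upper tail of the Dirac law at `0`. -/
def unitTail : ℝ → ℝ := (Set.Iic 0).indicator 1

theorem eta_eq_integral_gumbelTail {a : ℝ} (ha : 0 < a) :
    eta a = ∫ x : ℝ, (gumbelTail a x - unitTail x) := by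
  have e1 : Set.EqOn (fun x => gumbelTail a x - unitTail x) (fun x => gumbelTail a x - 1)
      (Set.Iic 0) := fun x hx => by
    simp only [unitTail, Set.indicator_of_mem hx, Pi.one_apply]
  have e2 : Set.EqOn (fun x => gumbelTail a x - unitTail x) (gumbelTail a)
      (Set.Iic 0)ᶜ := fun x hx => by
    simp only [unitTail, Set.indicator_of_notMem hx, sub_zero]
  have i1 := (integrableOn_gumbelTail_sub_one_Iic ha).congr_fun e1.symm measurableSet_Iic
  have i2 : IntegrableOn (gumbelTail a) (Set.Iic 0)ᶜ := by
    rw [Set.compl_Iic]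
    exact integrableOn_gumbelTail_Ioi ha
  have i3 := i2.congr_fun e2.symm measurableSet_Iic.compl
  have hint : Integrable fun x => gumbelTail a x - unitTail x := by
    rw [← integrableOn_univ, ← Set.union_compl_self (Set.Iic (0 : ℝ))]
    exact i1.union i3
  rw [eta, ← integral_add_compl measurableSet_Iic (integrable_mul_gumbel_density ha),
    ← integral_add_compl (s := Set.Iic 0) measurableSet_Iic hint,
    setIntegral_congr_fun measurableSet_Iic e1, setIntegral_congr_fun measurableSet_Iic.compl e2,
    Set.compl_Iic, integral_gumbelTail_Ioi ha, integral_gumbelTail_sub_one_Iic ha]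

/-! ### The mean as a rescaled integral, and dominated convergence -/

theorem integrable_groundTailReal_sub {s : ℝ} (hs : 0 ≤ s) (N : ℕ) :
    Integrable (fun t => groundTailReal s N t - unitTail t) ∧
      ∫ t in Set.Ioc 0 (N : ℝ), groundTailReal s N t
        = ∫ t : ℝ, (groundTailReal s N t - unitTail t) := by
  have he : (fun t => groundTailReal s N t - unitTail t)
      = (Set.Ioc 0 (N : ℝ)).indicator (groundTailReal s N) := by
    funext t
    rcases le_or_gt t 0 with ht | ht
    · rw [Set.indicator_of_notMem (fun h => absurd h.1 (not_lt.mpr ht)),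
        groundTailReal_of_nonpos s N ht, unitTail, Set.indicator_of_mem (by exact ht)]
      simp
    · rw [unitTail, Set.indicator_of_notMem (s := Set.Iic 0) (not_le.mpr ht), sub_zero]
      rcases le_or_gt t N with htN | htN
      · rw [Set.indicator_of_mem (show t ∈ Set.Ioc 0 (N : ℝ) from ⟨ht, htN⟩)]
      · rw [Set.indicator_of_notMem (fun h => absurd h.2 (not_le.mpr htN)),
          groundTailReal_of_lt s htN]
  rw [he, integral_indicator measurableSet_Ioc]
  refine ⟨IntegrableOn.integrable_indicator ?_ measurableSet_Ioc, rfl⟩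
  rw [← intervalIntegrable_iff_integrableOn_Ioc_of_le N.cast_nonneg]
  exact (groundTailReal_antitone hs N).intervalIntegrable

/-- Moving the step of `unitTail` from 0 to c changes the integral by exactly c; the substitution t
= c + hx leaves the step at x = 0 because h > 0. -/
theorem integral_groundTailReal_affine {s c h : ℝ} (hs : 0 ≤ s) (N : ℕ) (hc : 0 ≤ c) (hh : 0 < h) :
    (∫ t in Set.Ioc 0 (N : ℝ), groundTailReal s N t)
      = c + h * ∫ x : ℝ, (groundTailReal s N (c + h * x) - unitTail x) := by
  obtain ⟨hi, he⟩ := integrable_groundTailReal_sub hs N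
  have hstep : (fun t => unitTail (t - c) - unitTail t) = (Set.Ioc 0 c).indicator 1 := by
    funext t
    simp only [unitTail, Set.indicator_apply, Set.mem_Iic, Set.mem_Ioc, sub_nonpos, Pi.one_apply]
    split_ifs <;> grind
  have hstep_int : Integrable (fun t => unitTail (t - c) - unitTail t) := by
    rw [hstep]
    exact (integrable_indicator_iff measurableSet_Ioc).mpr (integrableOn_const (by simp))
  have hstep_val : ∫ t, (unitTail (t - c) - unitTail t) = c := by
    rw [hstep, integral_indicator_one measurableSet_Ioc]
    simp [hc]
  have h1 : ∫ x : ℝ, (groundTailReal s N (c + h * x) - unitTail x)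
      = h⁻¹ * ∫ t : ℝ, (groundTailReal s N t - unitTail (t - c)) := by
    have h2 := Measure.integral_comp_mul_left
      (fun y => groundTailReal s N (c + y) - unitTail (c + y - c)) h
    have h3 := integral_add_left_eq_self (μ := volume)
      (fun t => groundTailReal s N t - unitTail (t - c)) c
    rw [h3, abs_of_pos (inv_pos.mpr hh), smul_eq_mul] at h2
    rw [← h2]
    congr 1
    funext x
    congr 1
    rw [add_sub_cancel_left]
    simp only [unitTail, Set.indicator_apply, Set.mem_Iic, Pi.one_apply]
    have : h * x ≤ 0 ↔ x ≤ 0 := by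
      constructor
      · intro hx
        by_contra! hx'
        exact absurd (mul_pos hh hx') (not_lt.mpr hx)
      · exact fun hx => mul_nonpos_of_nonneg_of_nonpos hh.le hx
    simp only [this]
  have h4 : ∫ t : ℝ, (groundTailReal s N t - unitTail (t - c))
      = (∫ t : ℝ, (groundTailReal s N t - unitTail t)) - c := by
    have h5 := integral_sub hi hstep_int
    rw [hstep_val] at h5
    rw [← h5]
    congr 1
    funext t
    ring
  rw [he, h1, h4]
  field_simp
  ring

theorem measurable_unitTail : Measurable unitTail :=
  measurable_one.indicator measurableSet_Iic

theorem abs_groundTailReal_rpow_sub_le {a : ℝ} (ha : 0 < a) {N : ℕ} (hN : 2 ≤ N) (x : ℝ) :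
    |groundTailReal (trapSpacing a N) N ((N : ℝ) ^ a * x) - unitTail x| ≤ Real.exp (-(1 * |x|)) := by
  rcases le_or_gt x 0 with hx | hx
  · rw [groundTailReal_of_nonpos _ _ (mul_nonpos_of_nonneg_of_nonpos (by positivity) hx), unitTail,
      Set.indicator_of_mem (by exact hx)]
    simpa using (Real.exp_pos _).le
  · rw [unitTail, Set.indicator_of_notMem (s := Set.Iic 0) (not_le.mpr hx), sub_zero, one_mul,
      abs_of_pos hx, abs_of_nonneg (groundTailReal_nonneg (trapSpacing_nonneg ha N) N _), mul_comm]
    refine (groundTail_le_exp (trapSpacing_nonneg ha N) N _).trans (Real.exp_le_exp.mpr ?_)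
    exact neg_le_neg (le_tailExponent_rpow ha hN x)

theorem tendsto_integral_groundTailReal_rpow {a : ℝ} (ha : 0 < a) (ha1 : a < 1) :
    Tendsto (fun N : ℕ =>
      ∫ x : ℝ, (groundTailReal (trapSpacing a N) N ((N : ℝ) ^ a * x) - unitTail x))
      atTop (𝓝 1) := by
  have hval : ∫ x : ℝ, (Set.Ioi (0 : ℝ)).indicator (fun x => Real.exp (-x)) x = 1 := by
    rw [integral_indicator measurableSet_Ioi, integral_exp_neg_Ioi_zero]
  rw [← hval]
  refine tendsto_integral_filter_of_dominated_convergence _ ?_ ?_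
    (integrable_exp_neg_mul_abs one_pos) ?_
  · filter_upwards with N
    exact (((groundTailReal_antitone (trapSpacing_nonneg ha N) N).measurable.comp
      (measurable_const_mul _)).sub measurable_unitTail).aestronglyMeasurable
  · filter_upwards [eventually_ge_atTop 2] with N hN
    exact Eventually.of_forall fun x => abs_groundTailReal_rpow_sub_le ha hN x
  · refine Eventually.of_forall fun x => ?_
    rcases le_or_gt x 0 with hx | hx
    · rw [Set.indicator_of_notMem (s := Set.Ioi 0) (not_lt.mpr hx)]
      refine tendsto_const_nhds.congr fun N => ?_
      rw [groundTailReal_of_nonpos _ _ (mul_nonpos_of_nonneg_of_nonpos (by positivity) hx),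
        unitTail, Set.indicator_of_mem (by exact hx), Pi.one_apply, sub_self]
    · rw [Set.indicator_of_mem (by exact hx), unitTail,
        Set.indicator_of_notMem (s := Set.Iic 0) (not_le.mpr hx)]
      simp only [sub_zero, mul_comm _ x]
      exact tendsto_groundTailReal_rpow ha ha1 hx.le

/-- The dominating function, uniform in N. For x ≤ 0 the Weierstrass inequality bounds the
difference by a multiple of e^{ax}; for x > 0 the exponent is at least x/2. -/
theorem abs_groundTailReal_gumbel_sub_le {a : ℝ} (ha : 1 ≤ a) {N : ℕ} (hN : 3 ≤ N)
    (hs1 : trapSpacing a N ≤ 1) (x : ℝ) :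
    |groundTailReal (trapSpacing a N) N (gumbelThreshold a N x) - unitTail x|
      ≤ Real.exp 1 * Real.exp (-(1 / 2 * |x|)) := by
  have ha0 : 0 < a := by linarith
  have hN2 : 2 ≤ N := by omega
  have hN0 : (0 : ℝ) < N := by exact_mod_cast (by omega : 0 < N)
  have hl := log_natCast_pos hN2
  have hs := trapSpacing_pos ha0 hN2
  set s := trapSpacing a N with hsdef
  have hs' : Real.log N / N = a⁻¹ * s := by
    rw [hsdef, trapSpacing]
    field_simp
  have hexp := exp_trapSpacing_mul_gumbelThreshold ha0 hN2 x
  rw [hs', ← hsdef] at hexp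
  have he1 : s ≤ Real.exp s - 1 := by linarith [Real.add_one_le_exp s]
  have hmul := mul_tailExponent s N ⌈gumbelThreshold a N x⌉₊
  have hL0 : 0 ≤ tailExponent s N ⌈gumbelThreshold a N x⌉₊ :=
    Finset.sum_nonneg fun _ _ => (Real.exp_pos _).le
  rcases le_or_gt x 0 with hx | hx
  · rw [unitTail, Set.indicator_of_mem (by exact hx), Pi.one_apply, abs_sub_comm,
      abs_of_nonneg (sub_nonneg.mpr (groundTailReal_le_one hs.le N _)), abs_of_nonpos hx]
    rcases le_or_gt (gumbelThreshold a N x) 0 with ht | ht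
    · rw [groundTailReal_of_nonpos _ _ ht, sub_self]
      positivity
    · refine (one_sub_groundTail_le hs.le N _).trans ?_
      have hceil : Real.exp (s * ⌈gumbelThreshold a N x⌉₊ - s * N)
          ≤ a⁻¹ * s * Real.exp (a * x) * Real.exp s := by
        rw [← hexp, ← Real.exp_add]
        refine Real.exp_le_exp.mpr ?_
        nlinarith [Nat.ceil_lt_add_one ht.le]
      have h1 : s * tailExponent s N ⌈gumbelThreshold a N x⌉₊
          ≤ s * (a⁻¹ * Real.exp (a * x) * Real.exp s) := by
        refine (mul_le_mul_of_nonneg_right he1 hL0).trans ?_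
        rw [hmul]
        refine le_trans (by linarith [Real.exp_pos (-(s * N))]) (hceil.trans_eq (by ring))
      refine (le_of_mul_le_mul_left h1 hs).trans ?_
      calc a⁻¹ * Real.exp (a * x) * Real.exp s
          ≤ 1 * Real.exp (a * x) * Real.exp 1 := by
            gcongr
            exact inv_le_one_of_one_le₀ ha
        _ = Real.exp 1 * Real.exp (a * x) := by ring
        _ ≤ _ := by
            gcongr
            nlinarith
  · rw [unitTail, Set.indicator_of_notMem (s := Set.Iic 0) (not_le.mpr hx), sub_zero,
      abs_of_nonneg (groundTailReal_nonneg hs.le N _), abs_of_pos hx]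
    -- With L the exponent, 2sL ≥ (e^s - 1)L ≥ a^{-1}s(e^{ax} - 1) ≥ sx. Here s ≤ 1 gives e^s - 1 ≤
    -- 2s, and N ≥ 3 gives log N ≥ 1, hence N^{-a} ≤ log N / N.
    have hbound : x / 2 ≤ tailExponent s N ⌈gumbelThreshold a N x⌉₊ := by
      have he2 : Real.exp s - 1 ≤ 2 * s := by
        have := Real.abs_exp_sub_one_le (x := s) (by rwa [abs_of_pos hs])
        rw [abs_of_pos hs] at this
        exact (le_abs_self _).trans this
      have hceil : a⁻¹ * s * Real.exp (a * x)
          ≤ Real.exp (s * ⌈gumbelThreshold a N x⌉₊ - s * N) := by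
        rw [← hexp]
        refine Real.exp_le_exp.mpr ?_
        have := mul_le_mul_of_nonneg_left (Nat.le_ceil (gumbelThreshold a N x)) hs.le
        linarith
      have hsmall : Real.exp (-(s * N)) ≤ a⁻¹ * s := by
        rw [exp_neg_trapSpacing_mul (by omega), ← hs']
        have hlog1 : 1 ≤ Real.log N := by
          rw [Real.le_log_iff_exp_le hN0]
          have : (3 : ℝ) ≤ N := by exact_mod_cast hN
          linarith [Real.exp_one_lt_d9]
        calc (N : ℝ) ^ (-a) ≤ (N : ℝ) ^ (-1 : ℝ) :=
              Real.rpow_le_rpow_of_exponent_le (by exact_mod_cast (by omega : 1 ≤ N)) (by linarith)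
          _ = 1 / N := by rw [Real.rpow_neg_one, one_div]
          _ ≤ Real.log N / N := by gcongr
      have hax : x ≤ a⁻¹ * (Real.exp (a * x) - 1) := by
        rw [inv_mul_eq_div, le_div_iff₀ ha0]
        linarith [Real.add_one_le_exp (a * x)]
      have h1 := mul_le_mul_of_nonneg_right he2 hL0
      rw [hmul] at h1
      have h2 := mul_le_mul_of_nonneg_left hax hs.le
      refine le_of_mul_le_mul_left (a := 2 * s) ?_ (by positivity)
      linarith
    refine ((groundTail_le_exp hs.le N _).trans (Real.exp_le_exp.mpr (neg_le_neg hbound))).trans ?_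
    rw [div_eq_mul_one_div, mul_comm x]
    exact le_mul_of_one_le_left (Real.exp_pos _).le (Real.one_le_exp zero_le_one)

theorem tendsto_integral_groundTailReal_gumbel {a : ℝ} (ha : 1 ≤ a) :
    Tendsto (fun N : ℕ =>
      ∫ x : ℝ, (groundTailReal (trapSpacing a N) N (gumbelThreshold a N x) - unitTail x))
      atTop (𝓝 (eta a)) := by
  have ha0 : 0 < a := by linarith
  rw [eta_eq_integral_gumbelTail ha0]
  refine tendsto_integral_filter_of_dominated_convergence _ ?_ ?_
    ((integrable_exp_neg_mul_abs one_half_pos).const_mul (Real.exp 1)) ?_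
  · filter_upwards with N
    refine Measurable.aestronglyMeasurable ?_
    refine ((groundTailReal_antitone (trapSpacing_nonneg ha0 N) N).measurable.comp ?_).sub
      measurable_unitTail
    unfold gumbelThreshold
    fun_prop
  · filter_upwards [eventually_ge_atTop 3, (tendsto_trapSpacing a).eventually_le_const one_pos]
      with N hN hs
    exact Eventually.of_forall fun x => abs_groundTailReal_gumbel_sub_le ha hN hs x
  · exact Eventually.of_forall fun x =>
      (tendsto_groundTailReal_gumbel ha (tendsto_const_nhds (x := x))).sub_const _

/-! ### Mean occupation and condensation -/

section Mean

variable {hbar ω β a : ℝ}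

theorem tendsto_trapMeanOcc_div_rpow (ha : a = hbar * ω * β) (ha0 : 0 < a) (ha1 : a < 1) :
    Tendsto (fun N : ℕ => trapMeanOcc hbar ω β N 0 / (N : ℝ) ^ a) atTop (𝓝 1) := by
  refine (tendsto_integral_groundTailReal_rpow ha0 ha1).congr' ?_
  filter_upwards [eventually_ge_atTop 2] with N hN
  have hN0 : (0 : ℝ) < N := by exact_mod_cast (by omega : 0 < N)
  have hp : 0 < (N : ℝ) ^ a := by positivity
  rw [trapMeanOcc_zero ha ha0 hN,
    integral_groundTailReal_affine (trapSpacing_nonneg ha0 N) N le_rfl hp]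
  simp only [zero_add]
  field_simp

/-- The mean ground-state occupation number on the scale of the Gumbel law. -/
theorem exists_trapMeanOcc_eq_gumbelThreshold (ha : a = hbar * ω * β) (ha1 : 1 ≤ a) :
    ∃ y : ℕ → ℝ, Tendsto y atTop (𝓝 (eta a)) ∧
      ∀ᶠ N : ℕ in atTop, trapMeanOcc hbar ω β N 0 = gumbelThreshold a N (y N) := by
  have ha0 : 0 < a := by linarith
  -- The witness is the integral of the rescaled tail minus the step, which the affine substitution
  -- turns into the mean.
  refine ⟨_, tendsto_integral_groundTailReal_gumbel ha1, ?_⟩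
  filter_upwards [eventually_ge_atTop 2,
    eventually_gumbelThreshold_nonneg ha1 (tendsto_const_nhds (x := 0))] with N hN hc
  have hN0 : (0 : ℝ) < N := by exact_mod_cast (by omega : 0 < N)
  have hl := log_natCast_pos hN
  have haff : ∀ x, gumbelThreshold a N x = gumbelThreshold a N 0 + N / Real.log N * x := fun x => by
    simp only [gumbelThreshold]
    ring
  rw [trapMeanOcc_zero ha ha0 hN, haff (∫ _, _),
    integral_groundTailReal_affine (trapSpacing_nonneg ha0 N) N hc (div_pos hN0 hl)]
  simp only [← haff]

theorem noBEC_of_tendsto (hhbar : 0 < hbar) (hω : 0 < ω) (hβ : 0 < β)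
    (h : Tendsto (fun N : ℕ => trapMeanOcc hbar ω β N 0 / N) atTop (𝓝 0)) :
    NoBEC (trapMeanOcc hbar ω β) := by
  intro c hc
  filter_upwards [h.eventually_le_const hc, eventually_ge_atTop 2] with N h1 hN j
  have hN0 : (0 : ℝ) < N := by exact_mod_cast (by omega : 0 < N)
  exact (trapMeanOcc_le hhbar hω hβ N hN j).trans ((div_le_iff₀ hN0).mp h1)

theorem tendsto_trapMeanOcc_div_of_lt (ha : a = hbar * ω * β) (ha0 : 0 < a) (ha1 : a < 1) :
    Tendsto (fun N : ℕ => trapMeanOcc hbar ω β N 0 / N) atTop (𝓝 0) := by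
  have h1 : Tendsto (fun N : ℕ => (N : ℝ) ^ (-(1 - a))) atTop (𝓝 0) :=
    (tendsto_rpow_neg_atTop (by linarith)).comp tendsto_natCast_atTop_atTop
  have h2 := (tendsto_trapMeanOcc_div_rpow ha ha0 ha1).mul h1
  rw [mul_zero] at h2
  refine h2.congr' ?_
  filter_upwards [eventually_ge_atTop 2] with N hN
  have hN0 : (0 : ℝ) < N := by exact_mod_cast (by omega : 0 < N)
  rw [neg_sub, Real.rpow_sub_one hN0.ne']
  field_simp

theorem isLittleO_trapMeanOcc_sub (ha : a = hbar * ω * β) (ha1 : 1 ≤ a) :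
    (fun N : ℕ => trapMeanOcc hbar ω β N 0 -
        ((1 - a⁻¹) * N + N / Real.log N * (a⁻¹ * Real.log (Real.log N) + eta a)))
      =o[atTop] (fun N : ℕ => (N : ℝ) / Real.log N) := by
  obtain ⟨y, hy, hyN⟩ := exists_trapMeanOcc_eq_gumbelThreshold ha ha1
  refine Asymptotics.isLittleO_of_tendsto' ?_ ?_
  · filter_upwards [eventually_ge_atTop 2] with N hN h0
    have hN0 : (0 : ℝ) < N := by exact_mod_cast (by omega : 0 < N)
    exact absurd h0 (div_pos hN0 (log_natCast_pos hN)).ne'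
  · have h := hy.sub_const (eta a)
    rw [sub_self] at h
    refine h.congr' ?_
    filter_upwards [eventually_ge_atTop 2, hyN] with N hN hm
    have hN0 : (0 : ℝ) < N := by exact_mod_cast (by omega : 0 < N)
    have hl := log_natCast_pos hN
    rw [hm, gumbelThreshold, eq_div_iff (div_pos hN0 hl).ne']
    ring

theorem tendsto_trapMeanOcc_div (ha : a = hbar * ω * β) (ha1 : 1 ≤ a) :
    Tendsto (fun N : ℕ => trapMeanOcc hbar ω β N 0 / N) atTop (𝓝 (1 - a⁻¹)) := by
  obtain ⟨y, hy, hyN⟩ := exists_trapMeanOcc_eq_gumbelThreshold ha ha1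
  have h1 : Tendsto (fun N : ℕ => (Real.log N)⁻¹) atTop (𝓝 0) :=
    tendsto_inv_atTop_zero.comp tendsto_log_natCast
  have h2 := (tendsto_gumbelThreshold_div a 0).add (h1.mul hy)
  rw [zero_mul, add_zero] at h2
  refine h2.congr' ?_
  filter_upwards [eventually_ge_atTop 2, hyN] with N hN hm
  have hN0 : (0 : ℝ) < N := by exact_mod_cast (by omega : 0 < N)
  have hl := log_natCast_pos hN
  rw [hm, gumbelThreshold, gumbelThreshold]
  field_simp
  ring

end Mean

/-! ### Free energy -/

/-- `∑_{k=1}^N -log (1 - e^{-s k})`. -/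
def logPartitionSum (s : ℝ) (N : ℕ) : ℝ :=
  ∑ k ∈ Finset.range N, -Real.log (1 - Real.exp (-s) ^ (k + 1))

/-- Expand each logarithm in its power series, exchange the sums, and sum the geometric progression
in k. The factor s makes each term converge as s → 0. -/
theorem logPartitionSum_eq_tsum {s : ℝ} (hs : 0 < s) (N : ℕ) :
    s * logPartitionSum s N = ∑' r : ℕ, 1 / ((r : ℝ) + 1) *
      ((1 - Real.exp (-(s * N)) ^ (r + 1)) * (s / (Real.exp (s * (r + 1)) - 1))) := by
  have hlog : ∀ k ∈ Finset.range N, HasSum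
      (fun r : ℕ => (Real.exp (-s) ^ (k + 1)) ^ (r + 1) / ((r : ℝ) + 1))
      (-Real.log (1 - Real.exp (-s) ^ (k + 1))) := fun k _ => by
    refine Real.hasSum_pow_div_log_of_abs_lt_one ?_
    rw [abs_of_pos (by positivity)]
    exact pow_lt_one₀ (Real.exp_pos _).le (Real.exp_lt_one_iff.mpr (by linarith)) k.succ_ne_zero
  have h := (hasSum_sum hlog).mul_left s
  rw [logPartitionSum, ← h.tsum_eq]
  refine tsum_congr fun r => ?_
  set y := Real.exp (-s) ^ (r + 1) with hy
  have hy0 : 0 < y := by positivity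
  have hy1 : y < 1 :=
    pow_lt_one₀ (Real.exp_pos _).le (Real.exp_lt_one_iff.mpr (by linarith)) r.succ_ne_zero
  have hyinv : Real.exp (s * (r + 1)) = y⁻¹ := by
    rw [hy, ← Real.exp_nat_mul, ← Real.exp_neg]
    push_cast
    ring_nf
  have hyN : Real.exp (-(s * N)) ^ (r + 1) = y ^ N := by
    have he : Real.exp (-(s * N)) = Real.exp (-s) ^ N := by
      rw [← Real.exp_nat_mul]
      ring_nf
    rw [hy, he, ← pow_mul, ← pow_mul, mul_comm]
  have hgeom : ∑ k ∈ Finset.range N, y ^ k = (1 - y ^ N) / (1 - y) := by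
    rw [geom_sum_eq hy1.ne, ← neg_div_neg_eq, neg_sub, neg_sub]
  have hsum : ∑ k ∈ Finset.range N, (Real.exp (-s) ^ (k + 1)) ^ (r + 1) / ((r : ℝ) + 1)
      = (∑ k ∈ Finset.range N, y ^ k) * y / (r + 1) := by
    rw [← Finset.sum_div, Finset.sum_mul]
    congr 1
    refine Finset.sum_congr rfl fun k _ => ?_
    rw [hy, ← pow_mul, ← pow_mul, ← pow_add]
    congr 1
    ring
  have h1y : 1 - y ≠ 0 := by linarith
  rw [hsum, hgeom, hyinv, hyN]
  have : y⁻¹ - 1 = (1 - y) / y := by field_simp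
  rw [this]
  field_simp

theorem tendsto_mul_logPartitionSum {a : ℝ} (ha : 0 < a) :
    Tendsto (fun N : ℕ => trapSpacing a N * logPartitionSum (trapSpacing a N) N) atTop
      (𝓝 (Real.pi ^ 2 / 6)) := by
  have hz : HasSum (fun r : ℕ => 1 / ((r : ℝ) + 1) ^ 2) (Real.pi ^ 2 / 6) := by
    have := (hasSum_nat_add_iff' 1).mpr hasSum_zeta_two
    simpa using this
  rw [← hz.tsum_eq]
  have hkey : Tendsto (fun N : ℕ => ∑' r : ℕ, 1 / ((r : ℝ) + 1) *
      ((1 - Real.exp (-(trapSpacing a N * N)) ^ (r + 1)) *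
        (trapSpacing a N / (Real.exp (trapSpacing a N * (r + 1)) - 1)))) atTop
      (𝓝 (∑' r : ℕ, 1 / ((r : ℝ) + 1) ^ 2)) := by
    -- Since e^v - 1 ≥ v, the limiting series Σ 1/(r+1)² is itself the majorant.
    refine tendsto_tsum_of_dominated_convergence hz.summable (fun r => ?_) ?_
    · have hr : (0 : ℝ) < r + 1 := by positivity
      have h1 : Tendsto (fun N : ℕ => Real.exp (-(trapSpacing a N * N))) atTop (𝓝 0) := by
        refine ((tendsto_rpow_neg_atTop ha).comp tendsto_natCast_atTop_atTop).congr' ?_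
        filter_upwards [eventually_ge_atTop 2] with N hN
        exact (exp_neg_trapSpacing_mul (by omega)).symm
      have h2 : Tendsto (fun N : ℕ => trapSpacing a N * ((r : ℝ) + 1)) atTop (𝓝 0) := by
        simpa using (tendsto_trapSpacing a).mul_const ((r : ℝ) + 1)
      have h3 := tendsto_exp_sub_one_div h2 ((eventually_ge_atTop 2).mono fun N hN =>
        mul_pos (trapSpacing_pos ha hN) hr)
      have h4 := (((h1.pow (r + 1)).const_sub 1).mul
        ((h3.inv₀ one_ne_zero).mul_const (1 / ((r : ℝ) + 1)))).const_mul (1 / ((r : ℝ) + 1))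
      have h5 : 1 / ((r : ℝ) + 1) * ((1 - 0 ^ (r + 1)) * ((1 : ℝ)⁻¹ * (1 / ((r : ℝ) + 1))))
          = 1 / ((r : ℝ) + 1) ^ 2 := by
        rw [zero_pow r.succ_ne_zero]
        field_simp
        norm_num
      rw [h5] at h4
      refine h4.congr fun N => ?_
      rw [inv_div]
      field_simp
    · filter_upwards [eventually_ge_atTop 2] with N hN r
      have hs := trapSpacing_pos ha hN
      have hr : (0 : ℝ) < r + 1 := by positivity
      have hsr := mul_pos hs hr
      have he : trapSpacing a N * (r + 1) ≤ Real.exp (trapSpacing a N * (r + 1)) - 1 := by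
        linarith [Real.add_one_le_exp (trapSpacing a N * (r + 1))]
      have hp0 : 0 < Real.exp (-(trapSpacing a N * N)) ^ (r + 1) := by positivity
      have hp1 : Real.exp (-(trapSpacing a N * N)) ^ (r + 1) ≤ 1 :=
        pow_le_one₀ (Real.exp_pos _).le (Real.exp_le_one_iff.mpr (neg_nonpos.mpr (by positivity)))
      have h6 : trapSpacing a N / (Real.exp (trapSpacing a N * (r + 1)) - 1) ≤ 1 / (r + 1) := by
        rw [div_le_div_iff₀ (by linarith) hr]
        linarith
      have h7 : 0 ≤ trapSpacing a N / (Real.exp (trapSpacing a N * (r + 1)) - 1) :=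
        div_nonneg hs.le (by linarith)
      rw [Real.norm_of_nonneg (mul_nonneg (by positivity) (mul_nonneg (by linarith) h7))]
      calc 1 / ((r : ℝ) + 1) * ((1 - Real.exp (-(trapSpacing a N * N)) ^ (r + 1)) *
            (trapSpacing a N / (Real.exp (trapSpacing a N * (r + 1)) - 1)))
          ≤ 1 / ((r : ℝ) + 1) * (1 * (1 / (r + 1))) := by
            gcongr
            linarith
        _ = 1 / ((r : ℝ) + 1) ^ 2 := by
            field_simp
  refine hkey.congr' ?_
  filter_upwards [eventually_ge_atTop 2] with N hN
  exact (logPartitionSum_eq_tsum (trapSpacing_pos ha hN) N).symm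

section FreeEnergy

variable {hbar ω β a : ℝ}

theorem freeEnergy_trap_eq (ha : a = hbar * ω * β) (ha0 : 0 < a) {N : ℕ} (hN : 2 ≤ N) :
    freeEnergy β (trapLevel hbar ω N) N
      = 1 / β * (a * Real.log N / 2 - logPartitionSum (trapSpacing a N) N) := by
  have hs := trapSpacing_pos ha0 hN
  have hq : ∀ k ∈ Finset.range N, 1 - Real.exp (-trapSpacing a N) ^ (k + 1) ≠ 0 := fun k _ => by
    have := pow_lt_one₀ (Real.exp_pos (-trapSpacing a N)).le
      (Real.exp_lt_one_iff.mpr (by linarith)) k.succ_ne_zero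
    exact (sub_pos.mpr this).ne'
  rw [freeEnergy, partitionFunction_eq (summable_trap ha ha0 hN) (trapLevel_succ N)
    (by rwa [mul_trapSpacing ha]), mul_trapSpacing ha, mul_trapLevel_zero ha,
    Real.log_div (by positivity) (Finset.prod_ne_zero_iff.mpr hq), Real.log_prod hq,
    Real.log_pow, Real.log_exp, logPartitionSum, Finset.sum_neg_distrib,
    ← trapSpacing_mul (by omega : N ≠ 0)]
  ring

theorem isLittleO_freeEnergy_sub (ha : a = hbar * ω * β) (ha0 : 0 < a) :
    (fun N : ℕ => freeEnergy β (trapLevel hbar ω N) N -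
        (-(Real.pi ^ 2 / (6 * β * a)) * (N / Real.log N)))
      =o[atTop] (fun N : ℕ => (N : ℝ) / Real.log N) := by
  refine Asymptotics.isLittleO_of_tendsto' ?_ ?_
  · filter_upwards [eventually_ge_atTop 2] with N hN h0
    have hN0 : (0 : ℝ) < N := by exact_mod_cast (by omega : 0 < N)
    exact absurd h0 (div_pos hN0 (log_natCast_pos hN)).ne'
  -- The zero-point energy contributes a log N / 2, negligible against N / log N.
  · have hlog2 : Tendsto (fun N : ℕ => Real.log N ^ 2 / N) atTop (𝓝 0) :=
      (Real.isLittleO_pow_log_id_atTop (n := 2)).tendsto_div_nhds_zero.comp tendsto_natCast_atTop_atTop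
    have h := ((hlog2.const_mul (a / 2)).sub
      ((tendsto_mul_logPartitionSum ha0).const_mul a⁻¹)).const_mul (1 / β)
    have h2 := h.add_const (Real.pi ^ 2 / (6 * β * a))
    have h3 : 1 / β * (a / 2 * 0 - a⁻¹ * (Real.pi ^ 2 / 6)) + Real.pi ^ 2 / (6 * β * a) = 0 := by
      rw [mul_zero, zero_sub, mul_assoc 6 β a, ← div_div, div_eq_mul_inv _ (β * a), mul_inv]
      ring
    rw [h3] at h2
    refine h2.congr' ?_
    filter_upwards [eventually_ge_atTop 2] with N hN
    have hN0 : (0 : ℝ) < N := by exact_mod_cast (by omega : 0 < N)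
    have hl := log_natCast_pos hN
    have hs : trapSpacing a N * logPartitionSum (trapSpacing a N) N
        = a * (Real.log N / N) * logPartitionSum (trapSpacing a N) N := rfl
    rw [freeEnergy_trap_eq ha ha0 hN, eq_div_iff (div_pos hN0 hl).ne', hs]
    field_simp
    ring

end FreeEnergy

end

end IdealBoseGas

/-! ### Assembly -/

theorem theorem3 (hbar ω β a : ℝ) (hhbar : 0 < hbar) (hω : 0 < ω) (hβ : 0 < β)
    (ha : a = hbar * ω * β) :
    -- the canonical ensemble is well defined (for one particle the scaled trap is flat)
    (∀ N : ℕ, 2 ≤ N → Summable (fun n : Config N => weight β (trapLevel hbar ω N) n)) ∧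
    -- the phase transition
    (a ≤ 1 → NoBEC (trapMeanOcc hbar ω β)) ∧
    (1 < a → GroundStateBEC (trapMeanOcc hbar ω β)) ∧
    -- exponential law of the ground-state occupation number below the transition
    (a < 1 → ∀ x : ℝ, 0 ≤ x →
      Tendsto (fun N : ℕ => groundProb hbar ω β N (fun n₀ => x ≤ n₀ / (N : ℝ) ^ a))
        atTop (𝓝 (Real.exp (-x)))) ∧
    -- concentration
    (1 ≤ a → ∀ (l : ℕ → ℝ) (l₀ : ℝ), 0 < l₀ → l₀ < 1 → Tendsto l atTop (𝓝 l₀) →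
      (l₀ < 1 - a⁻¹ →
        Tendsto (fun N : ℕ => groundProb hbar ω β N (fun n₀ => l N ≤ n₀ / N)) atTop (𝓝 1)) ∧
      (1 - a⁻¹ < l₀ →
        Tendsto (fun N : ℕ => groundProb hbar ω β N (fun n₀ => l N ≤ n₀ / N)) atTop (𝓝 0))) ∧
    -- Gumbel law, in two forms
    (1 ≤ a → ∀ x : ℝ,
      Tendsto (fun N : ℕ => groundProb hbar ω β N (fun n₀ =>
          x ≤ (n₀ / N - 1 + a⁻¹) * Real.log N - a⁻¹ * Real.log (Real.log N)))
        atTop (𝓝 (Real.exp (-(a⁻¹ * Real.exp (a * x)))))) ∧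
    Integrable (fun x : ℝ => x * Real.exp (a * x - a⁻¹ * Real.exp (a * x))) ∧
    (1 ≤ a → ∀ x : ℝ,
      Tendsto (fun N : ℕ => groundProb hbar ω β N (fun n₀ =>
          x ≤ Real.log N / N * (n₀ - trapMeanOcc hbar ω β N 0)))
        atTop (𝓝 (Real.exp (-(a⁻¹ * Real.exp (a * (x + eta a))))))) ∧
    -- mean value below the transition
    (a < 1 → Tendsto (fun N : ℕ => trapMeanOcc hbar ω β N 0 / (N : ℝ) ^ a) atTop (𝓝 1)) ∧
    -- mean value at and above the transition
    (1 ≤ a →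
      (fun N : ℕ => trapMeanOcc hbar ω β N 0 -
          ((1 - a⁻¹) * N + N / Real.log N * (a⁻¹ * Real.log (Real.log N) + eta a)))
        =o[atTop] (fun N : ℕ => (N : ℝ) / Real.log N)) ∧
    (1 ≤ a → Tendsto (fun N : ℕ => trapMeanOcc hbar ω β N 0 / N) atTop (𝓝 (1 - 1 / a))) ∧
    -- free energy
    (fun N : ℕ => freeEnergy β (trapLevel hbar ω N) N -
        (-(Real.pi ^ 2 / (6 * β * a)) * (N / Real.log N)))
      =o[atTop] (fun N : ℕ => (N : ℝ) / Real.log N) := by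
  have ha0 : 0 < a := by
    rw [ha]
    positivity
  have hprob : ∀ (S : ℕ → ℝ → Prop) (t : ℕ → ℝ) (c : ℝ),
      (∀ N : ℕ, 2 ≤ N → ∀ n₀ : ℕ, S N n₀ ↔ t N ≤ n₀) →
      Tendsto (fun N : ℕ => groundTailReal (trapSpacing a N) N (t N)) atTop (𝓝 c) →
      Tendsto (fun N : ℕ => groundProb hbar ω β N (S N)) atTop (𝓝 c) := by
    intro S t c hS h
    refine h.congr' ?_
    filter_upwards [eventually_ge_atTop 2] with N hN
    exact (groundProb_le_occ ha ha0 hN (S N) (t N) (hS N hN)).symm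
  have hpos : ∀ N : ℕ, 2 ≤ N → (0 : ℝ) < N := fun N hN => by
    exact_mod_cast (by omega : 0 < N)
  have hratio : ∀ l : ℕ → ℝ, ∀ N : ℕ, 2 ≤ N → ∀ n₀ : ℕ, l N ≤ n₀ / N ↔ l N * N ≤ n₀ :=
    fun l N hN n₀ => le_div_iff₀ (hpos N hN)
  refine ⟨fun N hN => summable_weight (summable_trap ha ha0 hN) N, ?_, ?_, ?_, ?_, ?_,
    integrable_mul_gumbel_density ha0, ?_, tendsto_trapMeanOcc_div_rpow ha ha0,
    isLittleO_trapMeanOcc_sub ha, ?_, isLittleO_freeEnergy_sub ha ha0⟩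
  · intro ha1
    refine noBEC_of_tendsto hhbar hω hβ ?_
    rcases ha1.lt_or_eq with h | h
    · exact tendsto_trapMeanOcc_div_of_lt ha ha0 h
    · simpa [h] using tendsto_trapMeanOcc_div ha h.ge
  · intro ha1
    have hgap : 0 < 1 - a⁻¹ := sub_pos.mpr (inv_lt_one_of_one_lt₀ ha1)
    refine ⟨(1 - a⁻¹) / 2, by positivity, ?_⟩
    filter_upwards [(tendsto_trapMeanOcc_div ha ha1.le).eventually_const_le (half_lt_self hgap),
      eventually_ge_atTop 2] with N h hN
    exact (le_div_iff₀ (hpos N hN)).mp h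
  · intro ha1 x hx
    refine hprob _ _ _ (fun N hN n₀ => ?_) (tendsto_groundTailReal_rpow ha0 ha1 hx)
    have := hpos N hN
    exact le_div_iff₀ (by positivity)
  · intro ha1 l l₀ _ _ hl
    exact ⟨fun h => hprob _ _ _ (hratio l) (tendsto_groundTailReal_of_lt ha1 hl h),
      fun h => hprob _ _ _ (hratio l) (tendsto_groundTailReal_of_gt ha1 hl h)⟩
  · intro ha1 x
    refine hprob _ _ _ (fun N hN n₀ => ?_)
      (tendsto_groundTailReal_gumbel ha1 (tendsto_const_nhds (x := x)))
    have hN0 := hpos N hN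
    have hl := log_natCast_pos hN
    -- The two inequalities agree after the first difference is multiplied by N / log N.
    rw [gumbelThreshold, ← sub_nonneg, ← sub_nonneg (b := _ + _),
      ← mul_nonneg_iff_of_pos_left (div_pos hN0 hl)]
    refine iff_of_eq (congrArg _ ?_)
    field_simp
    ring
  · intro ha1 x
    obtain ⟨y, hy, hyN⟩ := exists_trapMeanOcc_eq_gumbelThreshold ha ha1
    refine hprob _ (fun N => trapMeanOcc hbar ω β N 0 + N / Real.log N * x) _
      (fun N hN n₀ => ?_) ?_
    · have hN0 := hpos N hN
      have hl := log_natCast_pos hN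
      rw [← sub_nonneg, ← sub_nonneg (b := _ + _), ← mul_nonneg_iff_of_pos_left (div_pos hN0 hl)]
      refine iff_of_eq (congrArg _ ?_)
      field_simp
      ring
    -- The mean plus (N / log N) x is the Gumbel threshold at x + y_N, with y_N → η(a).
    · refine (tendsto_groundTailReal_gumbel ha1 (hy.const_add x)).congr' ?_
      filter_upwards [hyN] with N hm
      rw [hm]
      simp only [gumbelThreshold]
      ring_nf
  · intro ha1
    rw [one_div]
    exact tendsto_trapMeanOcc_div ha ha1
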